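/- Graphs are finite, undirected and loopless; parallel edges are allowed. A graph is $k$-connected if deleting any set of at most $k-1$ vertices leaves any two remaining vertices joined by a path. A planar embedding of a connected graph is a crossing-free drawing in the plane up to orientation-preserving homeomorphism of the plane, i.e. it is given by the clockwise cyclic order of the edge ends around every vertex (subject to Euler's formula) together with the choice of the outer face. A $3$-connected $3$-augmentation of a graph $G$ is a $3$-regular, $3$-connected planar graph $H$ containing $G$ as a subgraph. Lemma. Let $R$ be a $3$-regular $3$-connected planar graph, let $R_2$ be a $(\le 2)$-subdivision of $R$ (each edge of $R$ is subdivided with $0$, $1$ or $2$ vertices), and let $G$ be obtained from $R_2$ by attaching a new degree-$1$ vertex to each subdivision vertex. Let $\mathcal{E}$ be a planar embedding of $G$. Then the following are equivalent: (i) there is a $3$-connected $3$-augmentation $H$ of $G$ having a planar embedding whose restriction to $G$ is $\mathcal{E}$; (ii) no face of $\mathcal{E}$ has exactly one or exactly two incident degree-$1$ vertices. -/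

import Mathlib

universe u

/-- A loopless undirected multigraph with vertex type `V` and edge type `E`; parallel edges are
allowed. The edge `e` joins `endpt e false` and `endpt e true`; which of its two ends is listed
under `false` carries no meaning. Finiteness is assumed separately. -/
structure Multigraph (V E : Type u) where
  endpt : E → Bool → V
  loopless : ∀ e, endpt e false ≠ endpt e true

namespace Multigraph

variable {V E W B : Type u}

/-- A dart is an edge together with a direction: `(e, b)` starts at the end `endpt e b`. -/
abbrev Dart (_G : Multigraph V E) : Type u := E × Bool

/-- The vertex at which a dart starts. -/
def src (G : Multigraph V E) (d : G.Dart) : V := G.endpt d.1 d.2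

/-- The reversal of darts. -/
def rev (G : Multigraph V E) : Equiv.Perm G.Dart where
  toFun d := (d.1, !d.2)
  invFun d := (d.1, !d.2)
  left_inv d := by simp
  right_inv d := by simp

theorem src_rev_ne (G : Multigraph V E) (d : G.Dart) : G.src d ≠ G.src (G.rev d) := by
  obtain ⟨e, b⟩ := d
  cases b
  · exact G.loopless e
  · exact (G.loopless e).symm

/-- The degree of a vertex, parallel edges being counted with multiplicity. -/
noncomputable def degree (G : Multigraph V E) (v : V) : ℕ := {d : G.Dart | G.src d = v}.ncard

def IsRegular (G : Multigraph V E) (k : ℕ) : Prop := ∀ v, G.degree v = k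

/-- The underlying simple graph: parallel edges are merged. -/
def toSimpleGraph (G : Multigraph V E) : SimpleGraph V where
  Adj u v := ∃ d : G.Dart, G.src d = u ∧ G.src (G.rev d) = v
  symm := ⟨by
    rintro u v ⟨d, rfl, rfl⟩
    exact ⟨G.rev d, rfl, by simp [rev]⟩⟩
  loopless := ⟨by
    rintro u ⟨d, h1, h2⟩
    exact G.src_rev_ne d (h1.trans h2.symm)⟩

/-- `G` is `k`-connected: the deletion of any set of at most `k - 1` vertices does not disconnect
it (any two of the remaining vertices are joined by a walk in the remaining graph). -/
def IsKConnected (G : Multigraph V E) (k : ℕ) : Prop :=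
  ∀ S : Finset V, S.card < k → (G.toSimpleGraph.induce {v | v ∉ S}).Preconnected

/-- `G` as a subgraph of `H`: an injection of the vertices and an injection of the edges (given on
darts), compatible with incidence. -/
structure Inclusion (G : Multigraph V E) (H : Multigraph W B) where
  vert : V ↪ W
  dart : G.Dart ↪ H.Dart
  src_dart : ∀ d, H.src (dart d) = vert (G.src d)
  rev_dart : ∀ d, H.rev (dart d) = dart (G.rev d)

/-- A planar embedding of a connected multigraph with at least one edge, up to
orientation-preserving homeomorphism of the plane: the clockwise cyclic order `rot` of the darts
around every vertex, subject to Euler's formula, and the choice of the outer face. Its faces are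
the facial walks, i.e. the orbits of `d ↦ rot (rev d)`; the facial walk of a dart bounds the face
to the left of that dart. -/
structure PlaneEmbedding (G : Multigraph V E) where
  connected : G.toSimpleGraph.Connected
  rot : Equiv.Perm G.Dart
  /-- `rot` permutes the darts at each vertex in a single cycle. -/
  sameCycle_iff : ∀ d d' : G.Dart, rot.SameCycle d d' ↔ G.src d = G.src d'
  euler : Nat.card V + Nat.card (Quotient (Equiv.Perm.SameCycle.setoid (rot * G.rev))) =
    Nat.card E + 2
  outer : Quotient (Equiv.Perm.SameCycle.setoid (rot * G.rev))

/-- Planarity of a connected multigraph with at least one edge. -/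
def IsPlanar (G : Multigraph V E) : Prop := Nonempty G.PlaneEmbedding

namespace PlaneEmbedding

variable {G : Multigraph V E} {H : Multigraph W B}

/-- The step from a dart to the next dart of its facial walk. -/
def faceStep (𝓔 : G.PlaneEmbedding) : Equiv.Perm G.Dart := 𝓔.rot * G.rev

/-- The faces of an embedding, each given as a facial walk. -/
abbrev Face (𝓔 : G.PlaneEmbedding) : Type u :=
  Quotient (Equiv.Perm.SameCycle.setoid (𝓔.rot * G.rev))

/-- The face to the left of a dart. -/
def faceOf (𝓔 : G.PlaneEmbedding) (d : G.Dart) : 𝓔.Face := Quotient.mk _ d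

/-- A vertex is incident to a face if the facial walk visits it. -/
def Incident (𝓔 : G.PlaneEmbedding) (v : V) (f : 𝓔.Face) : Prop :=
  ∃ d : G.Dart, G.src d = v ∧ 𝓔.faceOf d = f

/-- The set of degree-1 vertices incident to the face `f`. -/
def leavesAt (𝓔 : G.PlaneEmbedding) (f : 𝓔.Face) : Set V :=
  {v | G.degree v = 1 ∧ 𝓔.Incident v f}

/-- For a subgraph `G` of an embedded graph `H`: the faces of `H` to the left of the darts `a` and
`b` lie in one region after everything outside `G` has been erased from the drawing, i.e. one gets
from one of them to the other by crossing only edges outside `G`. -/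
def SameRegion (𝓗 : H.PlaneEmbedding) (φ : G.Inclusion H) : H.Dart → H.Dart → Prop :=
  Relation.EqvGen fun a b => b = 𝓗.faceStep a ∨ (b = H.rev a ∧ a ∉ Set.range φ.dart)

/-- The embedding `𝓗` of `H` induces the embedding `𝓔` on the subgraph `G`: the clockwise
successor in `𝓔` of a dart `d` of `G` is the first dart of `G` that follows `d` in the clockwise
order of `𝓗`, and the outer face of `𝓗` lies inside the outer face of `𝓔`. -/
def Induces (𝓗 : H.PlaneEmbedding) (φ : G.Inclusion H) (𝓔 : G.PlaneEmbedding) : Prop :=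
  (∀ d : G.Dart, ∃ k : ℕ, 0 < k ∧ (𝓗.rot ^ k) (φ.dart d) = φ.dart (𝓔.rot d) ∧
    ∀ j : ℕ, 0 < j → j < k → (𝓗.rot ^ j) (φ.dart d) ∉ Set.range φ.dart) ∧
  ∃ (a : H.Dart) (b : G.Dart), 𝓗.faceOf a = 𝓗.outer ∧ 𝓔.faceOf b = 𝓔.outer ∧
    𝓗.SameRegion φ a (φ.dart b)

/-- There is a `3`-connected `3`-augmentation of `G` inducing `𝓔`: a finite `3`-regular
`3`-connected planar supergraph `H` of `G` with an embedding that induces `𝓔` on `G`. -/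
def HasSolution (𝓔 : G.PlaneEmbedding) : Prop :=
  ∃ (W B : Type u) (_ : Finite W) (_ : Finite B) (H : Multigraph W B),
    H.IsRegular 3 ∧ H.IsKConnected 3 ∧
      ∃ (φ : G.Inclusion H) (𝓗 : H.PlaneEmbedding), 𝓗.Induces φ 𝓔

end PlaneEmbedding

/-- The subdivision of `R` in which every edge `e` is replaced by a path with `s e` inner vertices
`⟨e, 0⟩, …, ⟨e, s e - 1⟩`, hence with `s e + 1` edges. The `i`-th edge of the path starts at the
`(i - 1)`-st inner vertex, or at an end of `e` if `i = 0`, and ends at the `i`-th inner vertex, or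
at the other end of `e` if `i = s e`. -/
def subdivide (R : Multigraph V E) (s : E → ℕ) :
    Multigraph (V ⊕ Σ e : E, Fin (s e)) (Σ e : E, Fin (s e + 1)) where
  endpt x b := match b with
    | false => Fin.cases (motive := fun _ => V ⊕ Σ e : E, Fin (s e))
        (Sum.inl (R.endpt x.1 false)) (fun j => Sum.inr ⟨x.1, j⟩) x.2
    | true => Fin.lastCases (motive := fun _ => V ⊕ Σ e : E, Fin (s e))
        (Sum.inl (R.endpt x.1 true)) (fun j => Sum.inr ⟨x.1, j⟩) x.2
  loopless := by
    rintro ⟨e, i⟩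
    dsimp only
    induction i using Fin.lastCases with
    | last =>
      rw [Fin.lastCases_last]
      generalize Fin.last (s e) = k
      induction k using Fin.cases with
      | zero => simpa using R.loopless e
      | succ j => simp
    | cast i =>
      rw [Fin.lastCases_castSucc]
      generalize hk : i.castSucc = k
      induction k using Fin.cases with
      | zero => simp
      | succ j =>
        simp only [Fin.cases_succ, ne_eq, Sum.inr.injEq, Sigma.mk.injEq, heq_eq_eq, true_and]
        rintro rfl
        simp [Fin.ext_iff] at hk

/-- The multigraph obtained from `G` by attaching a new degree-1 vertex to each vertex in `S`. -/
def attachLeaves (G : Multigraph V E) (S : Set V) : Multigraph (V ⊕ S) (E ⊕ S) where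
  endpt x b := match x, b with
    | Sum.inl e, b => Sum.inl (G.endpt e b)
    | Sum.inr v, false => Sum.inl v.1
    | Sum.inr v, true => Sum.inr v
  loopless := by
    rintro (e | v)
    · simpa using G.loopless e
    · simp

/-- The subdivision of `R` given by `s`, with a degree-1 vertex attached to each of its
subdivision vertices. -/
def leafySubdivision (R : Multigraph V E) (s : E → ℕ) :
    Multigraph ((V ⊕ Σ e : E, Fin (s e)) ⊕
        (Set.range Sum.inr : Set (V ⊕ Σ e : E, Fin (s e))))
      ((Σ e : E, Fin (s e + 1)) ⊕ (Set.range Sum.inr : Set (V ⊕ Σ e : E, Fin (s e)))) :=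
  (R.subdivide s).attachLeaves (Set.range Sum.inr)

end Multigraph

/-!
A combinatorial plane embedding is a rotation system satisfying Euler's formula, so both
directions rest on linear algebra over `ℚ`. For a connected rotation system, the coboundaries of
vertex potentials form a space of dimension `|V| - 1` and the jumps of face potentials across the
edges one of dimension `|F| - 1`; these two spaces of functions on the edges are orthogonal. Hence
`|V| + |F| ≤ |E| + 2` always (`card_vertex_add_card_face_le`), and equality means that every
circulation is the jump of a face potential (`PlaneEmbedding.exists_face_potential`). The latter
yields the Jordan curve theorem in the needed form: two darts of a subgraph that lie in the same
region of the drawing belong to the same face (`PlaneEmbedding.Induces.faceOf_eq_of_sameRegion`).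

Necessity (`PlaneEmbedding.HasSolution.ncard_leavesAt_ne`): all vertices of `G` other than the
leaves have degree three already, so whatever an augmentation has inside a face is attached to `G`
at the leaves of that face only. If there are one or two of them, their neighbours separate the
augmentation.

Sufficiency: in each face that has leaves, join them by a cycle in the order in which the facial
walk visits them (`LeafTour`). The result `leafCycles` is cubic. Its rotation system is plane
because its faces can be labelled by the leaves and the old faces, every label being used
(`LeafTour.label_surjective`), and the inequality above makes this lower bound exact. For cubic
graphs, 3-connectedness amounts to every edge cut having at least three edges. This passes from
`R` to the augmentation (`isThreeEdgeConnected_leafCycles`) because the cycles have length at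
least three and an edge of `R` carries at most two subdivision vertices.
-/

namespace Multigraph

universe v

variable {V E W B : Type u}

/-! ### Rotation systems and potentials -/

@[simp] theorem rev_rev (G : Multigraph V E) (d : G.Dart) : G.rev (G.rev d) = d := by
  simp [rev]

theorem rev_mk (G : Multigraph V E) (e : E) (b : Bool) : G.rev (e, b) = (e, !b) := rfl

theorem eq_of_sameCycle {α X : Type*} {σ : Equiv.Perm α} {k : α → X} (hk : ∀ x, k (σ x) = k x)
    {x y : α} (h : σ.SameCycle x y) : k x = k y := by
  obtain ⟨i, rfl⟩ := h
  have hi : ∀ n : ℕ, ∀ x, k ((σ ^ n) x) = k x := by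
    intro n
    induction n with
    | zero => intro x; rfl
    | succ n ih => intro x; rw [pow_succ', Equiv.Perm.mul_apply, hk, ih]
  cases i with
  | ofNat n => exact (hi n x).symm
  | negSucc n =>
    rw [← hi (n + 1) ((σ ^ (Int.negSucc n)) x)]
    simp [zpow_negSucc]

/-- In a connected graph with rotation system `rot`, one gets from any dart to any other by
rotations and reversals. -/
theorem dart_induction {G : Multigraph V E} (hG : G.toSimpleGraph.Connected)
    {rot : Equiv.Perm G.Dart} (hrot : ∀ d d', rot.SameCycle d d' ↔ G.src d = G.src d')
    {X : Type v} (k : G.Dart → X) (hrev : ∀ d, k (G.rev d) = k d) (hk : ∀ d, k (rot d) = k d)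
    (a b : G.Dart) : k a = k b := by
  have hcyc : ∀ d d' : G.Dart, G.src d = G.src d' → k d = k d' :=
    fun d d' h => eq_of_sameCycle hk ((hrot d d').2 h)
  have hwalk : ∀ u w : V, G.toSimpleGraph.Walk u w → ∀ a b : G.Dart, G.src a = u → G.src b = w →
      k a = k b := by
    intro u w p
    induction p with
    | nil => intro a b ha hb; exact hcyc a b (ha.trans hb.symm)
    | cons h p ih =>
      intro a b ha hb
      obtain ⟨d, hd, hd'⟩ := h
      rw [hcyc a d (ha.trans hd.symm), ← hrev d]
      exact ih _ _ hd' hb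
  obtain ⟨p⟩ := hG.preconnected (G.src a) (G.src b)
  exact hwalk _ _ p a b rfl rfl

theorem eq_of_adj_eq {G : Multigraph V E} (hG : G.toSimpleGraph.Connected) {X : Type v} (k : V → X)
    (h : ∀ e, k (G.endpt e false) = k (G.endpt e true)) (u w : V) : k u = k w := by
  obtain ⟨p⟩ := hG.preconnected u w
  induction p with
  | nil => rfl
  | cons hd p ih =>
    obtain ⟨⟨e, b⟩, rfl, rfl⟩ := hd
    rw [← ih]
    cases b
    · exact h e
    · exact (h e).symm

/-- The difference along each edge of a rational potential on the vertices. -/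
def vertexCoboundary (G : Multigraph V E) : (V → ℚ) →ₗ[ℚ] (E → ℚ) where
  toFun h e := h (G.endpt e true) - h (G.endpt e false)
  map_add' _ _ := by ext; simp; ring
  map_smul' _ _ := by ext; simp; ring

/-- The difference across each edge of a rational potential on the faces of a rotation system. -/
def faceCoboundary (G : Multigraph V E) (rot : Equiv.Perm G.Dart) :
    (Quotient (Equiv.Perm.SameCycle.setoid (rot * G.rev)) → ℚ) →ₗ[ℚ] (E → ℚ) where
  toFun g e := g (Quotient.mk _ (e, false)) - g (Quotient.mk _ (e, true))
  map_add' _ _ := by ext; simp; ring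
  map_smul' _ _ := by ext; simp; ring

theorem mk_rev_eq_mk_rot (G : Multigraph V E) (rot : Equiv.Perm G.Dart) (d : G.Dart) :
    (Quotient.mk (Equiv.Perm.SameCycle.setoid (rot * G.rev)) (G.rev d)) =
      Quotient.mk _ (rot d) := by
  refine Quotient.sound ⟨1, ?_⟩
  simp

/-- The jump of a face potential across the edges is a circulation: at every vertex it telescopes
around the rotation. -/
theorem sum_face_jump_mul_src [Fintype E] {G : Multigraph V E} {rot : Equiv.Perm G.Dart}
    (hsrc : ∀ d, G.src (rot d) = G.src d)
    (g : Quotient (Equiv.Perm.SameCycle.setoid (rot * G.rev)) → ℚ) (h : V → ℚ) :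
    ∑ d : G.Dart, (g (Quotient.mk _ d) - g (Quotient.mk _ (G.rev d))) * h (G.src d) = 0 := by
  simp only [sub_mul, Finset.sum_sub_distrib]
  rw [sub_eq_zero, ← Equiv.sum_comp rot]
  refine Finset.sum_congr rfl fun d _ => ?_
  rw [mk_rev_eq_mk_rot, hsrc]

theorem sum_dart_mul_src [Fintype E] (G : Multigraph V E) (x : G.Dart → ℚ)
    (hx : ∀ d, x (G.rev d) = - x d) (h : V → ℚ) :
    ∑ d : G.Dart, x d * h (G.src d) = - ∑ e, x (e, false) * G.vertexCoboundary h e := by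
  rw [Fintype.sum_prod_type, ← Finset.sum_neg_distrib]
  refine Finset.sum_congr rfl fun e _ => ?_
  have := hx (e, false)
  simp only [rev_mk, Bool.not_false] at this
  simp [vertexCoboundary, src, this]
  ring

theorem sum_faceCoboundary_mul_vertexCoboundary [Fintype E] {G : Multigraph V E}
    {rot : Equiv.Perm G.Dart} (hsrc : ∀ d, G.src (rot d) = G.src d)
    (g : Quotient (Equiv.Perm.SameCycle.setoid (rot * G.rev)) → ℚ) (h : V → ℚ) :
    ∑ e, G.faceCoboundary rot g e * G.vertexCoboundary h e = 0 := by
  have := sum_face_jump_mul_src hsrc g h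
  rw [sum_dart_mul_src G _ (by intro d; simp)] at this
  simpa [faceCoboundary, rev_mk] using this

/-- The two spaces of coboundaries are orthogonal for the standard positive definite form. -/
theorem disjoint_range_coboundary [Finite E] {G : Multigraph V E}
    {rot : Equiv.Perm G.Dart} (hsrc : ∀ d, G.src (rot d) = G.src d) :
    Disjoint (LinearMap.range (G.faceCoboundary rot)) (LinearMap.range G.vertexCoboundary) := by
  have := Fintype.ofFinite E
  rw [Submodule.disjoint_def]
  rintro x ⟨g, hg⟩ ⟨h, hh⟩
  have h0 := sum_faceCoboundary_mul_vertexCoboundary hsrc g h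
  rw [hg, hh] at h0
  ext e
  have := (Finset.sum_eq_zero_iff_of_nonneg (fun i _ => mul_self_nonneg (x i))).1 h0 e
    (Finset.mem_univ e)
  simpa using this

/-- A linear map on functions whose kernel consists of constant functions loses at most one
dimension. -/
theorem card_le_finrank_range_add_one {ι κ : Type*} [Finite ι] (f : (ι → ℚ) →ₗ[ℚ] (κ → ℚ))
    (hf : ∀ g, f g = 0 → ∀ i j, g i = g j) :
    Nat.card ι ≤ Module.finrank ℚ (LinearMap.range f) + 1 := by
  have := Fintype.ofFinite ι
  have h1 := f.finrank_range_add_finrank_ker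
  rw [Module.finrank_fintype_fun_eq_card, ← Nat.card_eq_fintype_card] at h1
  suffices Module.finrank ℚ (LinearMap.ker f) ≤ 1 by omega
  rcases isEmpty_or_nonempty ι with h | ⟨⟨i⟩⟩
  · rw [Nat.card_of_isEmpty] at h1
    omega
  · have : LinearMap.ker f ≤ Submodule.span ℚ {fun _ => (1 : ℚ)} := by
      intro g hg
      rw [Submodule.mem_span_singleton]
      refine ⟨g i, ?_⟩
      ext j
      simpa using hf g hg i j
    exact (Submodule.finrank_mono this).trans ((finrank_span_le_card _).trans (by simp))

theorem card_vertex_le [Finite V] {G : Multigraph V E} (hG : G.toSimpleGraph.Connected) :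
    Nat.card V ≤ Module.finrank ℚ (LinearMap.range G.vertexCoboundary) + 1 :=
  card_le_finrank_range_add_one _ fun g hg => eq_of_adj_eq hG g fun e => by
    have := congrFun hg e
    simp only [vertexCoboundary, LinearMap.coe_mk, AddHom.coe_mk, Pi.zero_apply] at this
    linarith

theorem card_face_le [Finite E] {G : Multigraph V E} (hG : G.toSimpleGraph.Connected)
    {rot : Equiv.Perm G.Dart} (hrot : ∀ d d', rot.SameCycle d d' ↔ G.src d = G.src d') :
    Nat.card (Quotient (Equiv.Perm.SameCycle.setoid (rot * G.rev))) ≤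
      Module.finrank ℚ (LinearMap.range (G.faceCoboundary rot)) + 1 := by
  refine card_le_finrank_range_add_one _ fun g hg => ?_
  have hrev : ∀ d : G.Dart, g (Quotient.mk _ (G.rev d)) = g (Quotient.mk _ d) := by
    rintro ⟨e, b⟩
    have := congrFun hg e
    simp only [faceCoboundary, LinearMap.coe_mk, AddHom.coe_mk, Pi.zero_apply] at this
    cases b
    · simp only [rev_mk, Bool.not_false]; linarith
    · simp only [rev_mk, Bool.not_true]; linarith
  have h := dart_induction hG hrot (fun d => g (Quotient.mk _ d)) hrev fun d => by
    rw [← mk_rev_eq_mk_rot, hrev]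
  intro i j
  induction i using Quotient.inductionOn
  induction j using Quotient.inductionOn
  exact h _ _

/-- The genus of a connected rotation system is nonnegative. -/
theorem card_vertex_add_card_face_le [Finite V] [Finite E] {G : Multigraph V E}
    (hG : G.toSimpleGraph.Connected) {rot : Equiv.Perm G.Dart}
    (hrot : ∀ d d', rot.SameCycle d d' ↔ G.src d = G.src d') :
    Nat.card V + Nat.card (Quotient (Equiv.Perm.SameCycle.setoid (rot * G.rev))) ≤
      Nat.card E + 2 := by
  have := Fintype.ofFinite E
  have hsrc : ∀ d, G.src (rot d) = G.src d := fun d => ((hrot _ _).1 ⟨1, by simp⟩).symm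
  have h1 := card_vertex_le hG
  have h2 := card_face_le hG hrot
  have h3 := Submodule.finrank_add_finrank_le_of_disjoint
    (disjoint_range_coboundary (G := G) (rot := rot) hsrc)
  rw [Module.finrank_fintype_fun_eq_card, ← Nat.card_eq_fintype_card] at h3
  omega

namespace PlaneEmbedding

variable {G : Multigraph V E} {H : Multigraph W B}

theorem src_rot (𝓔 : G.PlaneEmbedding) (d : G.Dart) : G.src (𝓔.rot d) = G.src d :=
  ((𝓔.sameCycle_iff _ _).1 ⟨1, by simp⟩).symm

theorem faceOf_rev (𝓔 : G.PlaneEmbedding) (d : G.Dart) :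
    𝓔.faceOf (G.rev d) = 𝓔.faceOf (𝓔.rot d) :=
  mk_rev_eq_mk_rot G 𝓔.rot d

theorem faceOf_faceStep (𝓔 : G.PlaneEmbedding) (d : G.Dart) :
    𝓔.faceOf (𝓔.faceStep d) = 𝓔.faceOf d := by
  rw [faceStep, Equiv.Perm.mul_apply, ← faceOf_rev, rev_rev]

/-- In the plane every circulation is the jump of a face potential. By Euler's formula the
coboundaries of vertex potentials and of face potentials, which are orthogonal, together span all
functions on the edges. -/
theorem exists_face_potential [Finite V] [Fintype E] (𝓔 : G.PlaneEmbedding) (x : G.Dart → ℚ)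
    (hx : ∀ d, x (G.rev d) = - x d) (hflow : ∀ h : V → ℚ, ∑ d : G.Dart, x d * h (G.src d) = 0) :
    ∃ g : 𝓔.Face → ℚ, ∀ d, x d = g (𝓔.faceOf d) - g (𝓔.faceOf (G.rev d)) := by
  have hd := disjoint_range_coboundary (G := G) (rot := 𝓔.rot) 𝓔.src_rot
  have htop :
      LinearMap.range (G.faceCoboundary 𝓔.rot) ⊔ LinearMap.range G.vertexCoboundary = ⊤ := by
    refine Submodule.eq_top_of_disjoint _ _ ?_ hd
    have h1 := card_vertex_le 𝓔.connected
    have h2 := card_face_le 𝓔.connected 𝓔.sameCycle_iff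
    have h3 := 𝓔.euler
    have h4 := Submodule.finrank_add_finrank_le_of_disjoint hd
    rw [Module.finrank_fintype_fun_eq_card, ← Nat.card_eq_fintype_card] at *
    omega
  obtain ⟨_, ⟨g, rfl⟩, _, ⟨h, rfl⟩, hsum⟩ :=
    Submodule.mem_sup.1 (htop ▸ Submodule.mem_top : (fun e => x (e, false)) ∈ _)
  have hzero : G.vertexCoboundary h = 0 := by
    have h1 := hflow h
    rw [sum_dart_mul_src G x hx, neg_eq_zero] at h1
    have h2 := sum_faceCoboundary_mul_vertexCoboundary (G := G) (rot := 𝓔.rot) 𝓔.src_rot g h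
    have h3 : ∑ e, G.vertexCoboundary h e * G.vertexCoboundary h e = 0 := by
      rw [← sub_eq_zero.2 (h1.trans h2.symm), ← Finset.sum_sub_distrib]
      refine Finset.sum_congr rfl fun e _ => ?_
      rw [← congrFun hsum e, Pi.add_apply]
      ring
    ext e
    have := (Finset.sum_eq_zero_iff_of_nonneg fun i _ => mul_self_nonneg _).1 h3 e
      (Finset.mem_univ e)
    simpa using this
  rw [hzero, add_zero] at hsum
  refine ⟨g, ?_⟩
  rintro ⟨e, b⟩
  have he : x (e, false) = g (𝓔.faceOf (e, false)) - g (𝓔.faceOf (e, true)) :=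
    (congrFun hsum e).symm
  cases b
  · exact he
  · have := hx (e, false)
    simp only [rev_mk, Bool.not_false, Bool.not_true] at this ⊢
    rw [this, he]
    ring

end PlaneEmbedding

/-! ### Regions of a subgraph -/

namespace PlaneEmbedding

variable {G : Multigraph V E} {H : Multigraph W B}

theorem sameRegion_rev_rot_self (𝓗 : H.PlaneEmbedding) (φ : G.Inclusion H) (a : H.Dart) :
    𝓗.SameRegion φ (H.rev a) (𝓗.rot a) :=
  .rel _ _ (Or.inl (by simp [faceStep]))

theorem sameRegion_rev (𝓗 : H.PlaneEmbedding) (φ : G.Inclusion H) {a : H.Dart}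
    (ha : a ∉ Set.range φ.dart) : 𝓗.SameRegion φ a (H.rev a) :=
  .rel _ _ (Or.inr ⟨rfl, ha⟩)

theorem sameRegion_rot (𝓗 : H.PlaneEmbedding) (φ : G.Inclusion H) {a : H.Dart}
    (ha : a ∉ Set.range φ.dart) : 𝓗.SameRegion φ a (𝓗.rot a) :=
  .trans _ _ _ (𝓗.sameRegion_rev φ ha) (𝓗.sameRegion_rev_rot_self φ a)

/-- The facial walks of the induced embedding stay within one region. -/
theorem Induces.sameRegion_rev_rot {𝓗 : H.PlaneEmbedding} {φ : G.Inclusion H}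
    {𝓔 : G.PlaneEmbedding} (h : 𝓗.Induces φ 𝓔) (d : G.Dart) :
    𝓗.SameRegion φ (φ.dart (G.rev d)) (φ.dart (𝓔.rot d)) := by
  obtain ⟨k, hk, hkd, hj⟩ := h.1 d
  rw [← hkd, ← φ.rev_dart]
  have key : ∀ j, j < k → 𝓗.SameRegion φ (H.rev (φ.dart d)) ((𝓗.rot ^ (j + 1)) (φ.dart d)) := by
    intro j
    induction j with
    | zero => intro _; simpa using 𝓗.sameRegion_rev_rot_self φ (φ.dart d)
    | succ j ih =>
      intro hjk
      rw [pow_succ', Equiv.Perm.mul_apply]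
      exact .trans _ _ _ (ih (by omega)) (𝓗.sameRegion_rot φ (hj _ (by omega) hjk))
  simpa [Nat.sub_add_cancel hk] using key (k - 1) (by omega)

/-- Distinct faces of the induced embedding lie in distinct regions. This is the Jordan curve
theorem in combinatorial form: the boundary of a face `f` of the subgraph is a circulation, hence
the jump of a face potential of the supergraph, and this potential is constant on every region and
agrees with the indicator of `f` up to a constant. -/
theorem Induces.faceOf_eq_of_sameRegion [Finite E] [Finite W] [Finite B] {𝓗 : H.PlaneEmbedding}
    {φ : G.Inclusion H} {𝓔 : G.PlaneEmbedding} (hind : 𝓗.Induces φ 𝓔) {a b : G.Dart}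
    (hab : 𝓗.SameRegion φ (φ.dart a) (φ.dart b)) : 𝓔.faceOf a = 𝓔.faceOf b := by
  classical
  have := Fintype.ofFinite E
  have := Fintype.ofFinite B
  -- the boundary circulation `y` of the face of `a`, extended by zero to `x`
  let χ : 𝓔.Face → ℚ := fun f => if f = 𝓔.faceOf a then 1 else 0
  let y : G.Dart → ℚ := fun d => χ (𝓔.faceOf d) - χ (𝓔.faceOf (G.rev d))
  let x : H.Dart → ℚ := Function.extend φ.dart y 0
  have hxφ : ∀ d, x (φ.dart d) = y d := φ.dart.injective.extend_apply y 0
  have hx0 : ∀ c, c ∉ Set.range φ.dart → x c = 0 := fun c hc =>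
    Function.extend_apply' _ _ _ hc
  have hrange : ∀ c, H.rev c ∈ Set.range φ.dart → c ∈ Set.range φ.dart := by
    rintro c ⟨d, hd⟩
    exact ⟨G.rev d, by rw [← φ.rev_dart, hd, rev_rev]⟩
  have hxrev : ∀ c, x (H.rev c) = - x c := by
    intro c
    by_cases hc : c ∈ Set.range φ.dart
    · obtain ⟨d, rfl⟩ := hc
      rw [φ.rev_dart, hxφ, hxφ]
      simp [y]
    · rw [hx0 c hc, hx0 _ (fun h => hc (hrange c h)), neg_zero]
  have hflow : ∀ h : W → ℚ, ∑ c : H.Dart, x c * h (H.src c) = 0 := by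
    intro h
    rw [← sum_face_jump_mul_src 𝓔.src_rot χ (fun v => h (φ.vert v))]
    symm
    refine Fintype.sum_of_injective φ.dart φ.dart.injective _ _ (fun c hc => ?_) (fun d => ?_)
    · rw [hx0 c hc, zero_mul]
    · rw [hxφ, φ.src_dart]
      rfl
  obtain ⟨g, hg⟩ := 𝓗.exists_face_potential x hxrev hflow
  have hregion : ∀ c c', 𝓗.SameRegion φ c c' → g (𝓗.faceOf c) = g (𝓗.faceOf c') := by
    intro c c' h
    induction h with
    | rel c c' h =>
      rcases h with rfl | ⟨rfl, hc⟩
      · rw [faceOf_faceStep]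
      · have := hg c
        rw [hx0 c hc] at this
        linarith
    | refl => rfl
    | symm _ _ _ ih => exact ih.symm
    | trans _ _ _ _ _ ih1 ih2 => exact ih1.trans ih2
  have hk : ∀ d, g (𝓗.faceOf (φ.dart (G.rev d))) - χ (𝓔.faceOf (G.rev d)) =
      g (𝓗.faceOf (φ.dart d)) - χ (𝓔.faceOf d) := by
    intro d
    have := hg (φ.dart d)
    rw [hxφ, φ.rev_dart] at this
    simp only [y] at this
    linarith
  have hconst := dart_induction 𝓔.connected 𝓔.sameCycle_iff
    (fun d => g (𝓗.faceOf (φ.dart d)) - χ (𝓔.faceOf d)) hk (fun d => by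
      rw [← hk d, 𝓔.faceOf_rev, hregion _ _ (hind.sameRegion_rev_rot d)]) a b
  have h := hregion _ _ hab
  have hχ : χ (𝓔.faceOf b) = χ (𝓔.faceOf a) := by
    linarith
  by_contra hne
  simp [χ, Ne.symm hne] at hχ

end PlaneEmbedding

/-! ### Attached leaves and the necessity of three leaves per face -/

section attachLeaves

variable (G : Multigraph V E) (S : Set V)

@[simp] theorem src_attachLeaves_inl (e : E) (b : Bool) :
    (G.attachLeaves S).src (Sum.inl e, b) = Sum.inl (G.src (e, b)) := rfl

@[simp] theorem src_attachLeaves_inr_false (l : S) :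
    (G.attachLeaves S).src (Sum.inr l, false) = Sum.inl l.1 := rfl

@[simp] theorem src_attachLeaves_inr_true (l : S) :
    (G.attachLeaves S).src (Sum.inr l, true) = Sum.inr l := rfl

/-- The dart that starts at the attached vertex `l`. -/
abbrev leafDart (l : S) : (G.attachLeaves S).Dart := (Sum.inr l, true)

variable {G S}

theorem src_attachLeaves_eq_inr {d : (G.attachLeaves S).Dart} {l : S} :
    (G.attachLeaves S).src d = Sum.inr l ↔ d = G.leafDart S l := by
  obtain ⟨e | m, b⟩ := d
  · simp
  · cases b <;> simp

theorem degree_attachLeaves_inr (l : S) : (G.attachLeaves S).degree (Sum.inr l) = 1 := by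
  simp only [degree, src_attachLeaves_eq_inr]
  exact Set.ncard_singleton _

theorem mem_leavesAt_inr {𝓔 : (G.attachLeaves S).PlaneEmbedding} {f : 𝓔.Face} {l : S} :
    Sum.inr l ∈ 𝓔.leavesAt f ↔ 𝓔.faceOf (G.leafDart S l) = f := by
  constructor
  · rintro ⟨-, d, hd, hf⟩
    rwa [← src_attachLeaves_eq_inr.1 hd]
  · exact fun h => ⟨degree_attachLeaves_inr l, _, rfl, h⟩

end attachLeaves

namespace PlaneEmbedding

section

variable {G : Multigraph V E} {H : Multigraph W B}

/-- The darts at a vertex of the supergraph lie in one region if at most one of them belongs to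
the subgraph. -/
theorem sameRegion_of_src_eq [Finite B] (𝓗 : H.PlaneEmbedding) (φ : G.Inclusion H)
    {y z : H.Dart} (hyz : H.src y = H.src z)
    (h : ∀ c, H.src c = H.src z → c ∈ Set.range φ.dart → c = z) : 𝓗.SameRegion φ y z := by
  obtain ⟨n, -, hn⟩ := ((𝓗.sameCycle_iff y z).2 hyz).exists_pow_eq'
  induction n generalizing y with
  | zero =>
    obtain rfl : y = z := by simpa using hn
    exact .refl _
  | succ n ih =>
    by_cases hy : y ∈ Set.range φ.dart
    · rw [h y hyz hy]
      exact .refl _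
    · exact .trans _ _ _ (𝓗.sameRegion_rot φ hy)
        (ih ((𝓗.src_rot y).trans hyz) (by rwa [pow_succ, Equiv.Perm.mul_apply] at hn))

/-- A vertex whose degree is already attained in the subgraph meets no further edges. -/
theorem mem_range_dart_of_degree_eq [Finite B] (φ : G.Inclusion H) {v : V}
    (hv : H.degree (φ.vert v) = G.degree v) {c : H.Dart} (hc : H.src c = φ.vert v) :
    c ∈ Set.range φ.dart := by
  have hsub : φ.dart '' {d | G.src d = v} ⊆ {c | H.src c = φ.vert v} := by
    rintro _ ⟨d, rfl, rfl⟩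
    exact φ.src_dart d
  have heq := Set.eq_of_subset_of_ncard_le hsub (by
    rw [Set.ncard_image_of_injective _ φ.dart.injective]
    exact hv.le)
  have : c ∈ φ.dart '' {d | G.src d = v} := heq ▸ hc
  obtain ⟨d, -, rfl⟩ := this
  exact ⟨d, rfl⟩

end

/-- If a face had one or two leaves, then removing their neighbours would cut off what the
supergraph has inside that face. -/
theorem HasSolution.ncard_leavesAt_ne [Finite V] [Finite E] {G : Multigraph V E} {S : Set V}
    (hdeg : ∀ v, (G.attachLeaves S).degree (Sum.inl v) = 3) (hS : ∃ v, v ∉ S)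
    {𝓔 : (G.attachLeaves S).PlaneEmbedding} (h : 𝓔.HasSolution) (f : 𝓔.Face) :
    (𝓔.leavesAt f).ncard ≠ 1 ∧ (𝓔.leavesAt f).ncard ≠ 2 := by
  classical
  obtain ⟨W, B, _, _, H, hreg, hconn, φ, 𝓗, hind⟩ := h
  suffices ¬ (0 < (𝓔.leavesAt f).ncard ∧ (𝓔.leavesAt f).ncard < 3) by omega
  rintro ⟨hpos, hlt⟩
  have hfin : (𝓔.leavesAt f).Finite := Set.toFinite _
  have hinl : ∀ v, Sum.inl v ∉ 𝓔.leavesAt f := fun v hv => by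
    have := hv.1
    rw [hdeg] at this
    omega
  obtain ⟨l₀, hl₀⟩ : ∃ l₀ : S, Sum.inr l₀ ∈ 𝓔.leavesAt f := by
    obtain ⟨v | l, hv⟩ := (Set.ncard_pos hfin).1 hpos
    · exact (hinl v hv).elim
    · exact ⟨l, hv⟩
  have hl₀' := mem_leavesAt_inr.1 hl₀
  let T : Finset W := hfin.toFinset.image (Sum.elim (φ.vert ∘ Sum.inl)
    (fun l : S => φ.vert (Sum.inl l.1)))
  have hT : T.card < 3 :=
    Finset.card_image_le.trans_lt (by rwa [← Set.ncard_eq_toFinset_card _ hfin])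
  have hmemT : ∀ l : S, Sum.inr l ∈ 𝓔.leavesAt f → φ.vert (Sum.inl l.1) ∈ T := fun l hl =>
    Finset.mem_image.2 ⟨Sum.inr l, hfin.mem_toFinset.2 hl, rfl⟩
  have hinlT : ∀ w ∈ T, ∃ l : S, w = φ.vert (Sum.inl l.1) := by
    intro w hw
    obtain ⟨v | l, hv, rfl⟩ := Finset.mem_image.1 hw
    · exact (hinl v (hfin.mem_toFinset.1 hv)).elim
    · exact ⟨l, rfl⟩
  -- the vertices of the supergraph that lie inside `f`, including the leaves of `f`
  let P : W → Prop := fun w =>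
    (∀ y, H.src y = w → 𝓗.SameRegion φ y (φ.dart (G.leafDart S l₀))) ∧
      ∀ v, φ.vert v = w → v ∈ 𝓔.leavesAt f
  have hleaf : ∀ (l : S) (y : H.Dart), H.src y = φ.vert (Sum.inr l) →
      𝓗.SameRegion φ y (φ.dart (G.leafDart S l)) := by
    intro l y hy
    refine 𝓗.sameRegion_of_src_eq φ (hy.trans (φ.src_dart (G.leafDart S l)).symm) ?_
    rintro _ hc ⟨d, rfl⟩
    rw [φ.src_dart, φ.src_dart] at hc
    rw [src_attachLeaves_eq_inr.1 (φ.vert.injective hc)]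
  have hstep : ∀ d : H.Dart, H.src (H.rev d) ∉ T → P (H.src d) → P (H.src (H.rev d)) := by
    intro d hdT hP
    have hd : d ∉ Set.range φ.dart := by
      rintro ⟨d, rfl⟩
      obtain ⟨v, hv⟩ : ∃ v, (G.attachLeaves S).src d = v := ⟨_, rfl⟩
      have hv' := hP.2 v (by rw [φ.src_dart, hv])
      obtain v | l := v
      · exact hinl v hv'
      · obtain rfl := src_attachLeaves_eq_inr.1 hv
        refine hdT ?_
        rw [φ.rev_dart, φ.src_dart]
        exact hmemT l hv'
    have hd' : H.rev d ∉ Set.range φ.dart := by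
      rintro ⟨c, hc⟩
      exact hd ⟨(G.attachLeaves S).rev c, by rw [← φ.rev_dart, hc, rev_rev]⟩
    have hreg' : 𝓗.SameRegion φ (H.rev d) (φ.dart (G.leafDart S l₀)) :=
      .trans _ _ _ (.symm _ _ (𝓗.sameRegion_rev φ hd)) (hP.1 d rfl)
    by_cases hw : H.src (H.rev d) ∈ Set.range φ.vert
    · obtain ⟨v | l, hv⟩ := hw
      · exact (hd' (mem_range_dart_of_degree_eq φ (by rw [hreg, hdeg]) hv.symm)).elim
      · have hl : 𝓗.SameRegion φ (φ.dart (G.leafDart S l)) (φ.dart (G.leafDart S l₀)) :=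
          .trans _ _ _ (.symm _ _ (hleaf l _ hv.symm)) hreg'
        refine ⟨fun y hy => .trans _ _ _ (hleaf l y (hy.trans hv.symm)) hl, fun v hv' => ?_⟩
        obtain rfl := φ.vert.injective (hv'.trans hv.symm)
        exact mem_leavesAt_inr.2 ((hind.faceOf_eq_of_sameRegion hl).trans hl₀')
    · refine ⟨fun y hy => .trans _ _ _ (𝓗.sameRegion_of_src_eq φ hy ?_) hreg',
        fun v hv => (hw ⟨v, hv⟩).elim⟩
      rintro _ hc ⟨c, rfl⟩
      exact (hw ⟨_, by rw [← φ.src_dart, hc]⟩).elim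
  have hwalk : ∀ u w, (H.toSimpleGraph.induce {v | v ∉ T}).Walk u w → P u → P w := by
    intro u w p
    induction p with
    | nil => exact id
    | @cons u w _ hadj p ih =>
      intro hu
      obtain ⟨d, hd, hd'⟩ := hadj
      have hd₁ : H.src d = u.1 := hd
      have hd₂ : H.src (H.rev d) = w.1 := hd'
      exact ih (hd₂ ▸ hstep d (hd₂ ▸ w.2) (hd₁ ▸ hu))
  obtain ⟨v₀, hv₀⟩ := hS
  have hmem₁ : φ.vert (Sum.inr l₀) ∉ T := fun h => by
    obtain ⟨l, hl⟩ := hinlT _ h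
    simpa using φ.vert.injective hl
  have hmem₂ : φ.vert (Sum.inl v₀) ∉ T := fun h => by
    obtain ⟨l, hl⟩ := hinlT _ h
    obtain rfl : v₀ = l.1 := by simpa using φ.vert.injective hl
    exact hv₀ l.2
  obtain ⟨p⟩ := hconn T hT ⟨_, hmem₁⟩ ⟨_, hmem₂⟩
  have hstart : P (φ.vert (Sum.inr l₀)) :=
    ⟨hleaf l₀, fun v hv => by rwa [φ.vert.injective hv]⟩
  exact hinl v₀ ((hwalk _ _ p hstart).2 _ rfl)

end PlaneEmbedding

/-! ### Edge cuts of cubic graphs -/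

/-- The edges with exactly one end in `A`. -/
def cut (G : Multigraph V E) (A : Set V) : Set E :=
  {e | ¬ (G.endpt e false ∈ A ↔ G.endpt e true ∈ A)}

theorem cut_compl (G : Multigraph V E) (A : Set V) : G.cut Aᶜ = G.cut A := by
  ext e
  simp only [cut, Set.mem_ofPred_eq, Set.mem_compl_iff, not_iff_not]

theorem cut_symmDiff (G : Multigraph V E) (A A' : Set V) :
    G.cut (symmDiff A A') = symmDiff (G.cut A) (G.cut A') := by
  ext e
  simp only [cut, Set.mem_symmDiff, Set.mem_ofPred_eq]
  tauto

theorem mem_cut_singleton {G : Multigraph V E} {v : V} {e : E} :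
    e ∈ G.cut {v} ↔ G.endpt e false = v ∨ G.endpt e true = v := by
  have := G.loopless e
  simp only [cut, Set.mem_ofPred_eq, Set.mem_singleton_iff]
  constructor
  · tauto
  · rintro (rfl | rfl)
    · simpa using this.symm
    · simpa using this

theorem src_rev_mem_cut {G : Multigraph V E} {A : Set V} {d : G.Dart} (h : G.src d ∈ A)
    (h' : G.src (G.rev d) ∉ A) : d.1 ∈ G.cut A := by
  obtain ⟨e, b⟩ := d
  cases b
  · exact fun hiff => h' (hiff.1 h)
  · exact fun hiff => h' (hiff.2 h)

theorem ncard_cut_singleton (G : Multigraph V E) (v : V) : (G.cut {v}).ncard = G.degree v := by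
  have himage : G.cut {v} = Prod.fst '' {d : G.Dart | G.src d = v} := by
    ext e
    simp only [mem_cut_singleton, Set.mem_image, Set.mem_ofPred_eq, Prod.exists, src]
    simp
  rw [himage, degree, Set.InjOn.ncard_image]
  rintro ⟨e, b⟩ hb ⟨e', b'⟩ hb' (rfl : e = e')
  simp only [src, Set.mem_ofPred_eq] at hb hb'
  have := G.loopless e
  cases b <;> cases b' <;> simp_all

/-- Every edge cut has at least three edges. -/
def IsThreeEdgeConnected (G : Multigraph V E) : Prop :=
  ∀ A : Set V, A.Nonempty → Aᶜ.Nonempty → 2 < (G.cut A).ncard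

theorem exists_mem_cut_of_preconnected {G : Multigraph V E} {T A : Set V}
    (hT : (G.toSimpleGraph.induce T).Preconnected) {p q : V} (hp : p ∈ T) (hpA : p ∈ A)
    (hq : q ∈ T) (hqA : q ∉ A) : ∃ e ∈ G.cut A, G.endpt e false ∈ T ∧ G.endpt e true ∈ T := by
  by_contra! hcon
  have hwalk : ∀ u w, (G.toSimpleGraph.induce T).Walk u w → u.1 ∈ A → w.1 ∈ A := by
    intro u w p
    induction p with
    | nil => exact id
    | @cons u w _ hadj p ih =>
      intro hu
      refine ih ?_
      by_contra hw
      obtain ⟨d, hd, hd'⟩ := hadj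
      have hd₁ : G.src d = u.1 := hd
      have hd₂ : G.src (G.rev d) = w.1 := hd'
      have hcut : d.1 ∈ G.cut A := src_rev_mem_cut (hd₁ ▸ hu) (hd₂ ▸ hw)
      obtain ⟨e, b⟩ := d
      have hu' := u.2
      have hw' := w.2
      rw [← hd₁] at hu'
      rw [← hd₂] at hw'
      cases b
      · exact hcon e hcut hu' hw'
      · exact hcon e hcut hw' hu'
  obtain ⟨w⟩ := hT ⟨p, hp⟩ ⟨q, hq⟩
  exact hqA (hwalk _ _ w hpA)

theorem IsKConnected.isThreeEdgeConnected [Finite E] {G : Multigraph V E} (hG : G.IsKConnected 3)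
    (hreg : G.IsRegular 3) : G.IsThreeEdgeConnected := by
  classical
  intro A hA hA'
  by_contra hlt
  rw [Set.two_lt_ncard_iff] at hlt
  push Not at hlt
  have htouch : ∀ e ∈ G.cut A, ∃ a ∈ A, ∃ b ∉ A, e ∈ G.cut {a} ∧ e ∈ G.cut {b} := by
    intro e he
    simp only [mem_cut_singleton]
    by_cases h : G.endpt e false ∈ A
    · exact ⟨_, h, _, fun h' => he ⟨fun _ => h', fun _ => h⟩, Or.inl rfl, Or.inr rfl⟩
    · refine ⟨G.endpt e true, ?_, _, h, Or.inr rfl, Or.inl rfl⟩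
      by_contra h'
      exact he ⟨fun x => (h x).elim, fun x => (h' x).elim⟩
  -- at most two cut edges: one vertex on each side suffices to cover them
  obtain ⟨a, haA, ha⟩ : ∃ a ∈ A, ∀ e ∈ G.cut A, ∀ e' ∈ G.cut A, e ∉ G.cut {a} →
      e' ∉ G.cut {a} → e = e' := by
    rcases (G.cut A).eq_empty_or_nonempty with h | ⟨e₁, he₁⟩
    · obtain ⟨a, ha⟩ := hA
      exact ⟨a, ha, by simp [h]⟩
    · obtain ⟨a, haA, -, -, ha, -⟩ := htouch e₁ he₁
      refine ⟨a, haA, fun e he e' he' hea hea' => hlt e₁ e e' he₁ he he' ?_ ?_⟩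
      · rintro rfl; exact hea ha
      · rintro rfl; exact hea' ha
  obtain ⟨b, hbA, hb⟩ : ∃ b ∉ A, ∀ e ∈ G.cut A, e ∈ G.cut {a} ∨ e ∈ G.cut {b} := by
    by_cases h : ∃ e ∈ G.cut A, e ∉ G.cut {a}
    · obtain ⟨e₂, he₂, hea⟩ := h
      obtain ⟨-, -, b, hbA, -, hb⟩ := htouch e₂ he₂
      refine ⟨b, hbA, fun e he => or_iff_not_imp_left.2 fun h => ?_⟩
      rwa [ha e he e₂ he₂ h hea]
    · push Not at h
      obtain ⟨b, hb⟩ := hA'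
      exact ⟨b, hb, fun e he => Or.inl (h e he)⟩
  have hsmall : ∀ v : V, G.cut A ≠ G.cut {v} := by
    intro v h
    have h3 : 2 < (G.cut {v}).ncard := by
      rw [ncard_cut_singleton, hreg]
      omega
    rw [← h] at h3
    obtain ⟨x, y, z, hx, hy, hz, hxy, hxz, hyz⟩ := (Set.two_lt_ncard_iff).1 h3
    exact hyz (hlt x y z hx hy hz hxy hxz)
  obtain ⟨p, hpA, hpa⟩ : ∃ p ∈ A, p ≠ a := by
    by_contra! h
    exact hsmall a (congrArg _ (Set.eq_singleton_iff_unique_mem.2 ⟨haA, h⟩))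
  obtain ⟨q, hqA, hqb⟩ : ∃ q ∉ A, q ≠ b := by
    by_contra! h
    refine hsmall b ?_
    rw [← cut_compl]
    exact congrArg _ (Set.eq_singleton_iff_unique_mem.2 ⟨hbA, h⟩)
  obtain ⟨e, he, h1, h2⟩ := exists_mem_cut_of_preconnected (A := A)
    (hG {a, b} (Finset.card_le_two.trans_lt (by norm_num))) (p := p) (q := q)
    (by simpa using ⟨hpa, fun h : p = b => hbA (h ▸ hpA)⟩) hpA
    (by simpa using ⟨fun h : q = a => hqA (h ▸ haA), hqb⟩) hqA
  have := hb e he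
  simp only [Set.mem_ofPred_eq, Finset.mem_insert, Finset.mem_singleton, not_or] at h1 h2
  simp only [mem_cut_singleton] at this
  tauto

/-- A cubic graph without edge cuts of size at most two has no separating set of at most two
vertices: distribute the vertices of a separating set `S` to the two sides so that the number of
cut edges is smallest; then every vertex of `S` meets at most one cut edge. -/
theorem IsThreeEdgeConnected.isKConnected [Finite V] [Finite E] {G : Multigraph V E}
    (hG : G.IsThreeEdgeConnected) (hreg : G.IsRegular 3) : G.IsKConnected 3 := by
  classical
  rintro S hS ⟨u, hu⟩ ⟨v, hv⟩
  by_contra hreach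
  let A₀ : Set V := {w | ∃ h : w ∉ S, (G.toSimpleGraph.induce {v | v ∉ S}).Reachable ⟨u, hu⟩ ⟨w, h⟩}
  obtain ⟨A, hA, hmin⟩ := Set.exists_min_image {A : Set V | ∀ w ∉ S, w ∈ A ↔ w ∈ A₀}
    (fun A => (G.cut A).ncard) (Set.toFinite _) ⟨A₀, fun _ _ => Iff.rfl⟩
  have hone : ∀ x ∈ S, (G.cut A ∩ G.cut {x}).ncard ≤ 1 := by
    intro x hx
    have h1 := hmin (symmDiff A {x}) (fun w hw => by
      rw [← hA w hw, Set.mem_symmDiff]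
      have : w ≠ x := by rintro rfl; exact hw hx
      simp [this])
    rw [cut_symmDiff] at h1
    have h2 := Set.ncard_inter_add_ncard_sdiff_eq_ncard (G.cut A) (G.cut {x}) (Set.toFinite _)
    have h3 := Set.ncard_inter_add_ncard_sdiff_eq_ncard (G.cut {x}) (G.cut A) (Set.toFinite _)
    rw [ncard_cut_singleton, hreg, Set.inter_comm] at h3
    have h4 : (symmDiff (G.cut A) (G.cut {x})).ncard ≤ _ := Set.ncard_union_le _ _
    omega
  have hcover : G.cut A ⊆ ⋃ x ∈ S, G.cut A ∩ G.cut {x} := by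
    intro e he
    simp only [Set.mem_iUnion, Set.mem_inter_iff, mem_cut_singleton]
    by_contra! h
    have h1 : G.endpt e false ∉ S := fun hx => (h _ hx he).1 rfl
    have h2 : G.endpt e true ∉ S := fun hx => (h _ hx he).2 rfl
    refine he ?_
    rw [hA _ h1, hA _ h2]
    have hadj : (G.toSimpleGraph.induce {v | v ∉ S}).Adj ⟨_, h1⟩ ⟨_, h2⟩ :=
      ⟨(e, false), rfl, rfl⟩
    exact ⟨fun ⟨_, h⟩ => ⟨h2, h.trans hadj.reachable⟩,
      fun ⟨_, h⟩ => ⟨h1, h.trans hadj.symm.reachable⟩⟩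
  have hcard : (G.cut A).ncard ≤ S.card := by
    refine (Set.ncard_le_ncard hcover (Set.toFinite _)).trans ?_
    refine (Finset.set_ncard_biUnion_le S _).trans ?_
    simpa using Finset.sum_le_card_nsmul S _ 1 hone
  have huA : u ∈ A := (hA u hu).2 ⟨hu, .refl _⟩
  have hvA : v ∉ A := fun h => hreach ((hA v hv).1 h).2
  have := hG A ⟨u, huA⟩ ⟨v, hvA⟩
  omega

/-! ### Joining the leaves by cycles -/

/-- `G` with a new vertex attached to each vertex of `S`, and with the attached vertices joined by
cycles: for each `l : S` there is an additional edge from `l` to `π l`. -/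
def leafCycles (G : Multigraph V E) (S : Set V) (π : Equiv.Perm S) (hπ : ∀ l, π l ≠ l) :
    Multigraph (V ⊕ S) ((E ⊕ S) ⊕ S) where
  endpt x b := match x, b with
    | Sum.inl e, b => (G.attachLeaves S).endpt e b
    | Sum.inr l, false => Sum.inr l
    | Sum.inr l, true => Sum.inr (π l)
  loopless := by
    rintro (e | l)
    · exact (G.attachLeaves S).loopless e
    · simpa using (hπ l).symm

section leafCycles

variable (G : Multigraph V E) (S : Set V) (π : Equiv.Perm S) (hπ : ∀ l, π l ≠ l)

@[simp] theorem src_leafCycles_inl (e : E ⊕ S) (b : Bool) :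
    (G.leafCycles S π hπ).src (Sum.inl e, b) = (G.attachLeaves S).src (e, b) := rfl

@[simp] theorem src_leafCycles_inr_false (l : S) :
    (G.leafCycles S π hπ).src (Sum.inr l, false) = Sum.inr l := rfl

@[simp] theorem src_leafCycles_inr_true (l : S) :
    (G.leafCycles S π hπ).src (Sum.inr l, true) = Sum.inr (π l) := rfl

theorem degree_leafCycles_inl (v : V) :
    (G.leafCycles S π hπ).degree (Sum.inl v) = (G.attachLeaves S).degree (Sum.inl v) := by
  let ι : (G.attachLeaves S).Dart → (G.leafCycles S π hπ).Dart := fun d => (Sum.inl d.1, d.2)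
  have hι : Function.Injective ι := by
    rintro ⟨e, b⟩ ⟨e', b'⟩ h
    simpa [ι] using h
  rw [degree, degree, ← Set.ncard_image_of_injective _ hι]
  congr 1
  ext ⟨e | l, b⟩
  · simp [ι]
  · cases b <;> simp [ι]

theorem degree_leafCycles_inr (l : S) : (G.leafCycles S π hπ).degree (Sum.inr l) = 3 := by
  rw [degree, Set.ncard_eq_three]
  refine ⟨(Sum.inl (Sum.inr l), true), (Sum.inr l, false), (Sum.inr (π⁻¹ l), true),
    by simp, by simp, by simp, ?_⟩
  ext ⟨(e | m) | m, b⟩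
  · simp
  · cases b <;> simp
  · cases b <;> simp [Equiv.eq_symm_apply]

end leafCycles

/-! ### Subdivisions -/

section subdivide

variable (R : Multigraph V E) (s : E → ℕ)

/-- The `i`-th vertex of the path that replaces the edge `e` in a subdivision, counted from `0`.
For `i > s e` it is the second end of `e`. -/
def pathVertex (e : E) (i : ℕ) : V ⊕ Σ e : E, Fin (s e) :=
  if i = 0 then Sum.inl (R.endpt e false)
  else if h : i - 1 < s e then Sum.inr ⟨e, ⟨i - 1, h⟩⟩ else Sum.inl (R.endpt e true)

theorem subdivide_endpt_false (e : E) (i : Fin (s e + 1)) :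
    (R.subdivide s).endpt ⟨e, i⟩ false = R.pathVertex s e i := by
  induction i using Fin.cases with
  | zero => rfl
  | succ j => simp [pathVertex, subdivide]

theorem subdivide_endpt_true (e : E) (i : Fin (s e + 1)) :
    (R.subdivide s).endpt ⟨e, i⟩ true = R.pathVertex s e (i + 1) := by
  induction i using Fin.lastCases with
  | last => simp [pathVertex, subdivide]
  | cast j => simp [pathVertex, subdivide]

theorem pathVertex_zero (e : E) : R.pathVertex s e 0 = Sum.inl (R.endpt e false) := rfl

theorem pathVertex_succ (e : E) (j : Fin (s e)) :
    R.pathVertex s e (j + 1) = Sum.inr ⟨e, j⟩ := by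
  simp [pathVertex]

theorem pathVertex_last (e : E) : R.pathVertex s e (s e + 1) = Sum.inl (R.endpt e true) := by
  simp [pathVertex]

theorem exists_not_iff_succ {P : ℕ → Prop} {a b : ℕ} (hab : a ≤ b) (h : ¬ (P a ↔ P b)) :
    ∃ i, a ≤ i ∧ i < b ∧ ¬ (P i ↔ P (i + 1)) := by
  by_contra! hcon
  refine h ?_
  induction b, hab using Nat.le_induction with
  | base => rfl
  | succ b hb ih =>
    have := hcon b hb (Nat.lt_succ_self b)
    have := ih (fun hb' => h (hb'.trans this)) fun i hi hib => hcon i hi (Nat.lt_succ_of_lt hib)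
    tauto

variable {R s}

/-- A path from one side of a cut to the other contains a cut edge. -/
theorem exists_mem_cut_subdivide {A : Set (V ⊕ Σ e : E, Fin (s e))} {e : E} {a b : ℕ}
    (hab : a ≤ b) (hb : b ≤ s e + 1)
    (h : ¬ (R.pathVertex s e a ∈ A ↔ R.pathVertex s e b ∈ A)) :
    ∃ i : Fin (s e + 1), a ≤ i ∧ i < b ∧ (⟨e, i⟩ : Σ e, Fin (s e + 1)) ∈ (R.subdivide s).cut A := by
  obtain ⟨i, hi, hib, hP⟩ := exists_not_iff_succ (P := fun i => R.pathVertex s e i ∈ A) hab h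
  refine ⟨⟨i, by omega⟩, hi, hib, ?_⟩
  rw [cut, Set.mem_ofPred_eq, subdivide_endpt_false, subdivide_endpt_true]
  exact hP

theorem exists_mem_cut_subdivide_of_mem_cut {A : Set (V ⊕ Σ e : E, Fin (s e))} {e : E}
    (he : e ∈ R.cut (Sum.inl ⁻¹' A)) :
    ∃ i : Fin (s e + 1), (⟨e, i⟩ : Σ e, Fin (s e + 1)) ∈ (R.subdivide s).cut A := by
  obtain ⟨i, -, -, hi⟩ := exists_mem_cut_subdivide (R := R) (A := A) (e := e) (Nat.zero_le _) le_rfl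
    (by rw [pathVertex_zero, pathVertex_last]; exact he)
  exact ⟨i, hi⟩

theorem exists_two_mem_cut_subdivide {A : Set (V ⊕ Σ e : E, Fin (s e))}
    (hA : ∀ v, Sum.inl v ∉ A) {e : E} {j : Fin (s e)} (hj : Sum.inr ⟨e, j⟩ ∈ A) :
    ∃ i i' : Fin (s e + 1), i ≠ i' ∧ (⟨e, i⟩ : Σ e, Fin (s e + 1)) ∈ (R.subdivide s).cut A ∧
      (⟨e, i'⟩ : Σ e, Fin (s e + 1)) ∈ (R.subdivide s).cut A := by
  have hlt := j.2
  obtain ⟨i, -, hi, hic⟩ := exists_mem_cut_subdivide (R := R) (A := A) (e := e) (a := 0)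
    (b := j + 1) (by omega) (by omega)
    (by rw [pathVertex_zero, pathVertex_succ]; exact fun h => hA _ (h.2 hj))
  obtain ⟨i', hi', -, hic'⟩ := exists_mem_cut_subdivide (R := R) (A := A) (e := e) (a := j + 1)
    (b := s e + 1) (by omega) (by omega)
    (by rw [pathVertex_last, pathVertex_succ]; exact fun h => hA _ (h.1 hj))
  exact ⟨i, i', fun h => by subst h; omega, hic, hic'⟩

theorem src_subdivide_eq_inl {d : (R.subdivide s).Dart} {v : V} :
    (R.subdivide s).src d = Sum.inl v ↔
      ∃ c : R.Dart, R.src c = v ∧ d = (⟨c.1, if c.2 then Fin.last _ else 0⟩, c.2) := by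
  obtain ⟨⟨e, i⟩, b⟩ := d
  constructor
  · cases b
    · induction i using Fin.cases with
      | zero =>
        intro h
        exact ⟨(e, false), by simpa [src, subdivide] using h, by simp⟩
      | succ j => intro h; simp [src, subdivide] at h
    · induction i using Fin.lastCases with
      | last =>
        intro h
        exact ⟨(e, true), by simpa [src, subdivide] using h, by simp⟩
      | cast j => intro h; simp [src, subdivide] at h
  · rintro ⟨⟨e', b'⟩, rfl, h⟩
    obtain ⟨h1, rfl⟩ := Prod.mk.injEq .. ▸ h
    obtain ⟨rfl, h2⟩ := Sigma.mk.inj_iff.1 h1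
    obtain rfl := eq_of_heq h2
    cases b <;> simp [src, subdivide]

theorem src_subdivide_eq_inr {d : (R.subdivide s).Dart} {e : E} {j : Fin (s e)} :
    (R.subdivide s).src d = Sum.inr ⟨e, j⟩ ↔
      d = (⟨e, j.succ⟩, false) ∨ d = (⟨e, j.castSucc⟩, true) := by
  obtain ⟨⟨e', i⟩, b⟩ := d
  cases b
  · induction i using Fin.cases with
    | zero =>
      simp only [src, subdivide, Fin.cases_zero, reduceCtorEq, Prod.mk.injEq, Sigma.mk.injEq,
        and_true, Bool.false_eq_true, and_false, or_false, false_iff, not_and]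
      rintro rfl h
      exact Fin.succ_ne_zero _ (eq_of_heq h).symm
    | succ i =>
      simp only [src, subdivide, Fin.cases_succ, Sum.inr.injEq, Sigma.mk.injEq, Prod.mk.injEq,
        and_true, Bool.false_eq_true, and_false, or_false]
      refine and_congr_right ?_
      rintro rfl
      simp
  · induction i using Fin.lastCases with
    | last =>
      simp only [src, subdivide, Fin.lastCases_last, reduceCtorEq, Prod.mk.injEq, Sigma.mk.injEq,
        and_true, Bool.true_eq_false, and_false, false_or, false_iff, not_and]
      rintro rfl h
      exact (Fin.castSucc_lt_last j).ne (eq_of_heq h).symm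
    | cast i =>
      simp only [src, subdivide, Fin.lastCases_castSucc, Sum.inr.injEq, Sigma.mk.injEq,
        Prod.mk.injEq, and_true, Bool.true_eq_false, and_false, false_or]
      refine and_congr_right ?_
      rintro rfl
      simp

/-- Every vertex of the leafy subdivision other than the leaves has degree three. -/
theorem degree_leafySubdivision_inl (hreg : R.IsRegular 3) (x : V ⊕ Σ e : E, Fin (s e)) :
    ((R.subdivide s).attachLeaves (Set.range Sum.inr)).degree (Sum.inl x) = 3 := by
  obtain v | ⟨e, j⟩ := x
  · rw [← hreg v, degree, degree]
    let ψ : R.Dart → ((R.subdivide s).attachLeaves (Set.range Sum.inr)).Dart :=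
      fun c => (Sum.inl ⟨c.1, if c.2 then Fin.last _ else 0⟩, c.2)
    have hψ : Function.Injective ψ := by
      rintro ⟨e, b⟩ ⟨e', b'⟩ h
      simp only [ψ, Prod.mk.injEq, Sum.inl.injEq, Sigma.mk.injEq] at h ⊢
      exact ⟨h.1.1, h.2⟩
    rw [← Set.ncard_image_of_injective _ hψ]
    congr 1
    ext ⟨y | l, b⟩
    · simp only [Set.mem_ofPred_eq, src_attachLeaves_inl, Sum.inl.injEq, src_subdivide_eq_inl,
        Set.mem_image, ψ, Prod.mk.injEq, @eq_comm _ y, @eq_comm _ b]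
    · cases b
      · obtain ⟨_, w, rfl⟩ := l
        simp [ψ]
      · simp [ψ]
  · rw [degree, Set.ncard_eq_three]
    refine ⟨(Sum.inl ⟨e, j.succ⟩, false), (Sum.inl ⟨e, j.castSucc⟩, true),
      (Sum.inr ⟨Sum.inr ⟨e, j⟩, ⟨_, rfl⟩⟩, false), by simp, by simp, by simp, ?_⟩
    ext ⟨y | l, b⟩
    · simp only [Set.mem_ofPred_eq, src_attachLeaves_inl, Sum.inl.injEq, src_subdivide_eq_inr]
      simp
    · cases b <;> simp [Subtype.ext_iff]

/-- The augmentation of a subdivided graph is three-edge-connected: an edge cut of size at most two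
does not separate the vertices of `R`; as a cycle has at least three leaves and their neighbours do
not all subdivide the same edge of `R`, nothing else can be cut off either. -/
theorem isThreeEdgeConnected_leafCycles [Finite V] [Finite E] (hR : R.IsThreeEdgeConnected)
    (hs : ∀ e, s e ≤ 2)
    {S : Set (V ⊕ Σ e : E, Fin (s e))} (hS : ∀ x, x ∈ S ↔ ∃ y, Sum.inr y = x)
    {π : Equiv.Perm S} (hπ : ∀ l, π l ≠ l) (hπ' : ∀ l, π (π l) ≠ l) :
    ((R.subdivide s).leafCycles S π hπ).IsThreeEdgeConnected := by
  let H := (R.subdivide s).leafCycles S π hπ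
  -- the case in which all vertices of `R` are on one side
  have main : ∀ A : Set ((V ⊕ Σ e : E, Fin (s e)) ⊕ S), (∀ v, Sum.inl (Sum.inl v) ∉ A) →
      A.Nonempty → 2 < (H.cut A).ncard := by
    intro A hV hne
    have hleg : ∀ l : S, (Sum.inl (Sum.inr l) : ((Σ e : E, Fin (s e + 1)) ⊕ S) ⊕ S) ∉ H.cut A →
        (Sum.inl l.1 ∈ A ↔ Sum.inr l ∈ A) := fun l h => not_not.1 h
    have hcyc : ∀ l : S, (Sum.inr l : ((Σ e : E, Fin (s e + 1)) ⊕ S) ⊕ S) ∉ H.cut A →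
        ((Sum.inr l : (V ⊕ Σ e : E, Fin (s e)) ⊕ S) ∈ A ↔ Sum.inr (π l) ∈ A) :=
      fun l h => not_not.1 h
    rw [Set.two_lt_ncard_iff]
    by_cases hinner : ∃ (e : E) (j : Fin (s e)), Sum.inl (Sum.inr ⟨e, j⟩) ∈ A
    · obtain ⟨e, j, hj⟩ := hinner
      obtain ⟨i, i', hii', hi, hi'⟩ := exists_two_mem_cut_subdivide (R := R) (s := s)
        (A := Sum.inl ⁻¹' A) hV hj
      -- without a third cut edge, a whole cycle with its stems is in `A`, with stems all on `e`
      by_contra! hcon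
      have honly : ∀ y ∈ H.cut A, y = Sum.inl (Sum.inl ⟨e, i⟩) ∨ y = Sum.inl (Sum.inl ⟨e, i'⟩) := by
        intro y hy
        by_contra! hne
        exact hne.2 (hcon (Sum.inl (Sum.inl ⟨e, i⟩)) (Sum.inl (Sum.inl ⟨e, i'⟩)) y hi hi' hy
          (by simpa using hii') hne.1.symm).symm
      have hnext : ∀ l : S, (Sum.inr l : (V ⊕ Σ e : E, Fin (s e)) ⊕ S) ∈ A → Sum.inr (π l) ∈ A :=
        fun l hl => (hcyc l fun h => by simpa using honly _ h).1 hl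
      have hstem : ∀ l : S, (Sum.inr l : (V ⊕ Σ e : E, Fin (s e)) ⊕ S) ∈ A →
          ∃ k : Fin (s e), l.1 = Sum.inr ⟨e, k⟩ := by
        rintro ⟨x, hx⟩ hl
        obtain ⟨⟨e', k⟩, rfl⟩ := (hS x).1 hx
        have hk := (hleg _ fun h => by simpa using honly _ h).2 hl
        obtain ⟨m, -, -, hm, -⟩ := exists_two_mem_cut_subdivide (R := R) (s := s)
          (A := Sum.inl ⁻¹' A) hV hk
        have : e' = e := by
          have := honly (Sum.inl (Sum.inl ⟨e', m⟩)) hm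
          simp only [Sum.inl.injEq, Sigma.mk.injEq] at this
          tauto
        subst this
        exact ⟨k, rfl⟩
      set l : S := ⟨Sum.inr ⟨e, j⟩, (hS _).2 ⟨_, rfl⟩⟩
      have hl : (Sum.inr l : (V ⊕ Σ e : E, Fin (s e)) ⊕ S) ∈ A :=
        (hleg l fun h => by simpa using honly _ h).1 hj
      obtain ⟨k₀, h0⟩ := hstem l hl
      obtain ⟨k₁, h1⟩ := hstem _ (hnext l hl)
      obtain ⟨k₂, h2⟩ := hstem _ (hnext _ (hnext l hl))
      have h01 : k₀ ≠ k₁ := by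
        rintro rfl
        exact hπ l (Subtype.ext (h1.trans h0.symm))
      have h12 : k₁ ≠ k₂ := by
        rintro rfl
        exact hπ (π l) (Subtype.ext (h2.trans h1.symm))
      have h02 : k₀ ≠ k₂ := by
        rintro rfl
        exact hπ' l (Subtype.ext (h2.trans h0.symm))
      have := hs e
      omega
    -- no subdivision vertex lies in `A`, so `A` consists of leaves
    · have hnone : ∀ l : S, Sum.inl l.1 ∉ A := by
        rintro ⟨x, hx⟩ h
        obtain ⟨⟨e, k⟩, rfl⟩ := (hS x).1 hx
        exact hinner ⟨e, k, h⟩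
      have hlegcut : ∀ l : S, (Sum.inr l : (V ⊕ Σ e : E, Fin (s e)) ⊕ S) ∈ A →
          (Sum.inl (Sum.inr l) : ((Σ e : E, Fin (s e + 1)) ⊕ S) ⊕ S) ∈ H.cut A := by
        intro l hl
        by_contra h
        exact hnone l ((hleg l h).2 hl)
      obtain ⟨l, hl⟩ : ∃ l : S, (Sum.inr l : (V ⊕ Σ e : E, Fin (s e)) ⊕ S) ∈ A := by
        obtain ⟨(v | ⟨e, j⟩) | l, hx⟩ := hne
        · exact (hV v hx).elim
        · exact (hinner ⟨e, j, hx⟩).elim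
        · exact ⟨l, hx⟩
      have h01 := hπ l
      have h12 := hπ (π l)
      have h02 := hπ' l
      by_cases h1 : (Sum.inr (π l) : (V ⊕ Σ e : E, Fin (s e)) ⊕ S) ∈ A
      · by_cases h2 : (Sum.inr (π (π l)) : (V ⊕ Σ e : E, Fin (s e)) ⊕ S) ∈ A
        · exact ⟨_, _, _, hlegcut l hl, hlegcut _ h1, hlegcut _ h2, by simpa using h01.symm,
            by simpa using h02.symm, by simpa using h12.symm⟩
        · refine ⟨_, _, Sum.inr (π l), hlegcut l hl, hlegcut _ h1, ?_, by simpa using h01.symm,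
            by simp, by simp⟩
          by_contra h
          exact h2 ((hcyc _ h).1 h1)
      · have hcut : (Sum.inr l : ((Σ e : E, Fin (s e + 1)) ⊕ S) ⊕ S) ∈ H.cut A := by
          by_contra h
          exact h1 ((hcyc _ h).1 hl)
        obtain ⟨m, rfl⟩ := π.surjective l
        by_cases h2 : (Sum.inr m : (V ⊕ Σ e : E, Fin (s e)) ⊕ S) ∈ A
        · exact ⟨_, _, _, hlegcut _ hl, hcut, hlegcut m h2, by simp,
            by simpa using hπ m, by simp⟩
        · refine ⟨_, _, Sum.inr m, hlegcut _ hl, hcut, ?_, by simp, by simp,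
            by simpa using hπ m⟩
          by_contra h
          exact h2 ((hcyc _ h).2 hl)
  intro A hA hA'
  let A₀ : Set (V ⊕ Σ e : E, Fin (s e)) := Sum.inl ⁻¹' A
  rcases (Sum.inl ⁻¹' A₀ : Set V).eq_empty_or_nonempty with h1 | h1
  · exact main A (fun v hv => (Set.eq_empty_iff_forall_notMem.1 h1 v) hv) hA
  rcases (Sum.inl ⁻¹' A₀ : Set V)ᶜ.eq_empty_or_nonempty with h2 | h2
  · rw [← cut_compl]
    exact main Aᶜ (fun v hv => (Set.eq_empty_iff_forall_notMem.1 h2 v) hv) hA'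
  obtain ⟨e₁, e₂, e₃, he₁, he₂, he₃, h12, h13, h23⟩ := (Set.two_lt_ncard_iff).1 (hR _ h1 h2)
  obtain ⟨i₁, hi₁⟩ := exists_mem_cut_subdivide_of_mem_cut he₁
  obtain ⟨i₂, hi₂⟩ := exists_mem_cut_subdivide_of_mem_cut he₂
  obtain ⟨i₃, hi₃⟩ := exists_mem_cut_subdivide_of_mem_cut he₃
  have hlift : ∀ x, x ∈ (R.subdivide s).cut A₀ → Sum.inl (Sum.inl x) ∈ H.cut A := fun x hx => hx
  rw [Set.two_lt_ncard_iff]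
  exact ⟨_, _, _, hlift _ hi₁, hlift _ hi₂, hlift _ hi₃, by simp [h12], by simp [h13],
    by simp [h23]⟩

end subdivide

/-! ### The cyclic order of the leaves of a face -/

/-- Along the cycles of a permutation of a finite set, one can keep track of the last visit to a
given subset, here the range of `ι`. -/
theorem exists_lastVisit {α S : Type*} [Finite α] (σ : Equiv.Perm α) (ι : S ↪ α) :
    ∃ r : α → Option S, (∀ l, r (ι l) = some l) ∧
      (∀ x, σ x ∉ Set.range ι → r (σ x) = r x) ∧
      (∀ x l, r x = some l → σ.SameCycle x (ι l)) ∧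
      (∀ x l, σ.SameCycle x (ι l) → r x ≠ none) := by
  classical
  let Last : α → S → Prop := fun x l =>
    ∃ n : ℕ, (σ⁻¹ ^ n) x = ι l ∧ ∀ m < n, (σ⁻¹ ^ m) x ∉ Set.range ι
  have huniq : ∀ x l l', Last x l → Last x l' → l = l' := by
    rintro x l l' ⟨n, hn, hlt⟩ ⟨n', hn', hlt'⟩
    rcases lt_trichotomy n n' with h | rfl | h
    · exact (hlt' n h ⟨l, hn.symm⟩).elim
    · exact ι.injective (hn.symm.trans hn')
    · exact (hlt n' h ⟨l', hn'.symm⟩).elim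
  let r : α → Option S := fun x => if h : ∃ l, Last x l then some h.choose else none
  have hr : ∀ x l, r x = some l ↔ Last x l := by
    intro x l
    by_cases h : ∃ l, Last x l
    · simp only [r, h, dif_pos, Option.some.injEq]
      exact ⟨fun h' => h' ▸ h.choose_spec, huniq x _ _ h.choose_spec⟩
    · simp only [r, h, dif_neg, not_false_iff, reduceCtorEq, false_iff]
      exact fun h' => h ⟨l, h'⟩
  refine ⟨r, fun l => (hr _ _).2 ⟨0, rfl, by simp⟩, fun x hx => ?_, fun x l h => ?_,
    fun x l h hnone => ?_⟩
  · ext l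
    rw [hr, hr]
    constructor
    · rintro ⟨_ | n, hn, hlt⟩
      · exact (hx ⟨l, hn.symm⟩).elim
      · refine ⟨n, by simpa [pow_succ] using hn, fun m hm => ?_⟩
        simpa [pow_succ] using hlt (m + 1) (by omega)
    · rintro ⟨n, hn, hlt⟩
      refine ⟨n + 1, by simpa [pow_succ] using hn, fun m hm => ?_⟩
      cases m with
      | zero => exact hx
      | succ m => simpa [pow_succ] using hlt m (by omega)
  · obtain ⟨n, hn, -⟩ := (hr x l).1 h
    rw [← Equiv.Perm.sameCycle_inv]
    exact ⟨n, by simpa using hn⟩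
  · rw [← Equiv.Perm.sameCycle_inv] at h
    obtain ⟨n, -, hn⟩ := h.exists_pow_eq'
    have hex : ∃ n : ℕ, (σ⁻¹ ^ n) x ∈ Set.range ι := ⟨n, l, hn.symm⟩
    obtain ⟨l', hl'⟩ := Nat.find_spec hex
    have := (hr x l').2 ⟨Nat.find hex, hl'.symm, fun m hm => Nat.find_min hex hm⟩
    rw [hnone] at this
    simp at this

/-- The order in which the facial walks of a plane embedding visit the attached leaves. -/
structure LeafTour {G : Multigraph V E} {S : Set V} (𝓔 : (G.attachLeaves S).PlaneEmbedding) where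
  /-- the next leaf on the facial walk -/
  next : Equiv.Perm S
  /-- the leaf that the facial walk has visited last, if the face has a leaf -/
  last : (G.attachLeaves S).Dart → Option S
  last_leafDart : ∀ l, last (G.leafDart S l) = some l
  last_faceStep : ∀ d, 𝓔.faceStep d ∉ Set.range (G.leafDart S) → last (𝓔.faceStep d) = last d
  last_toLeaf : ∀ l, last (Sum.inr (next l), false) = some l
  faceOf_eq : ∀ d l, last d = some l → 𝓔.faceOf d = 𝓔.faceOf (G.leafDart S l)
  last_ne_none : ∀ d l, 𝓔.faceOf d = 𝓔.faceOf (G.leafDart S l) → last d ≠ none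

section

variable {G : Multigraph V E} {S : Set V} {𝓔 : (G.attachLeaves S).PlaneEmbedding}

theorem rot_leafDart (𝓔 : (G.attachLeaves S).PlaneEmbedding) (l : S) :
    𝓔.rot (G.leafDart S l) = G.leafDart S l :=
  src_attachLeaves_eq_inr.1 (𝓔.src_rot _)

theorem faceStep_toLeaf (𝓔 : (G.attachLeaves S).PlaneEmbedding) (l : S) :
    𝓔.faceStep (Sum.inr l, false) = G.leafDart S l :=
  rot_leafDart 𝓔 l

theorem faceStep_eq_leafDart {d : (G.attachLeaves S).Dart} {l : S} :
    𝓔.faceStep d = G.leafDart S l ↔ d = (Sum.inr l, false) := by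
  rw [← faceStep_toLeaf 𝓔, 𝓔.faceStep.injective.eq_iff]

theorem exists_leafTour [Finite V] [Finite E] (𝓔 : (G.attachLeaves S).PlaneEmbedding) :
    Nonempty (LeafTour 𝓔) := by
  classical
  obtain ⟨r, hr1, hr2, hr3, hr4⟩ := exists_lastVisit 𝓔.faceStep
    (⟨G.leafDart S, fun l m h => by simpa using h⟩ : S ↪ (G.attachLeaves S).Dart)
  have hface : ∀ d l, 𝓔.faceStep.SameCycle d (G.leafDart S l) ↔
      𝓔.faceOf d = 𝓔.faceOf (G.leafDart S l) := fun d l =>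
    (Quotient.eq (r := Equiv.Perm.SameCycle.setoid _)).symm
  have hprev : ∀ l : S, ∃ m, r (Sum.inr l, false) = some m := by
    intro l
    refine Option.ne_none_iff_exists'.1 (hr4 _ l ⟨1, ?_⟩)
    exact faceStep_toLeaf 𝓔 l
  choose prev hprev using hprev
  have hsurj : Function.Surjective prev := by
    intro m
    have hex : ∃ n : ℕ, (𝓔.faceStep ^ (n + 1)) (G.leafDart S m) ∈ Set.range (G.leafDart S) := by
      refine ⟨orderOf 𝓔.faceStep - 1, m, ?_⟩
      rw [Nat.sub_add_cancel (orderOf_pos _), pow_orderOf_eq_one, Equiv.Perm.one_apply]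
    have hstay : ∀ n ≤ Nat.find hex, r ((𝓔.faceStep ^ n) (G.leafDart S m)) = some m := by
      intro n
      induction n with
      | zero => intro _; exact hr1 m
      | succ n ih =>
        intro hn
        have hmin := Nat.find_min hex (Nat.lt_of_succ_le hn)
        rw [pow_succ', Equiv.Perm.mul_apply] at hmin ⊢
        rw [hr2 _ hmin, ih (by omega)]
    obtain ⟨l, hl⟩ := Nat.find_spec hex
    rw [pow_succ', Equiv.Perm.mul_apply, eq_comm, faceStep_eq_leafDart] at hl
    refine ⟨l, ?_⟩
    have := hstay _ le_rfl
    rw [hl, hprev] at this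
    exact Option.some.inj this
  have hbij : Function.Bijective prev := Finite.surjective_iff_bijective.1 hsurj
  exact ⟨{
    next := (Equiv.ofBijective prev hbij).symm
    last := r
    last_leafDart := hr1
    last_faceStep := hr2
    last_toLeaf := fun l => by
      rw [hprev]
      exact congrArg some ((Equiv.ofBijective prev hbij).apply_symm_apply l)
    faceOf_eq := fun d l h => (hface d l).1 (hr3 d l h)
    last_ne_none := fun d l h => hr4 d l ((hface d l).2 h) }⟩

namespace LeafTour

variable (t : LeafTour 𝓔)

theorem faceOf_next (l : S) :
    𝓔.faceOf (G.leafDart S (t.next l)) = 𝓔.faceOf (G.leafDart S l) := by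
  rw [← t.faceOf_eq _ _ (t.last_toLeaf l), ← faceStep_toLeaf 𝓔, 𝓔.faceOf_faceStep]

/-- The leaves of one face form a single cycle of `next`. -/
theorem mem_of_closed [Finite V] [Finite E] {A : Set S} (hA : ∀ l, t.next l ∈ A → l ∈ A) {l m : S}
    (hl : l ∈ A) (h : 𝓔.faceOf (G.leafDart S l) = 𝓔.faceOf (G.leafDart S m)) : m ∈ A := by
  have hcyc : 𝓔.faceStep⁻¹.SameCycle (G.leafDart S l) (G.leafDart S m) :=
    Equiv.Perm.sameCycle_inv.2 (Quotient.exact h)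
  obtain ⟨n, -, hn⟩ := hcyc.exists_pow_eq'
  have key : ∀ n : ℕ, ∃ k ∈ A, t.last ((𝓔.faceStep⁻¹ ^ n) (G.leafDart S l)) = some k := by
    intro n
    induction n with
    | zero => exact ⟨l, hl, t.last_leafDart l⟩
    | succ n ih =>
      obtain ⟨k, hk, hlast⟩ := ih
      rw [pow_succ', Equiv.Perm.mul_apply]
      set x := (𝓔.faceStep⁻¹ ^ n) (G.leafDart S l)
      have hx : 𝓔.faceStep (𝓔.faceStep⁻¹ x) = x := by simp
      by_cases hmem : x ∈ Set.range (G.leafDart S)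
      · obtain ⟨k', hk'⟩ := hmem
        rw [← hk', t.last_leafDart, Option.some.injEq] at hlast
        subst hlast
        obtain ⟨j, rfl⟩ := t.next.surjective k'
        rw [← hk', faceStep_eq_leafDart] at hx
        exact ⟨j, hA j hk, by rw [← hk', hx, t.last_toLeaf]⟩
      · refine ⟨k, hk, ?_⟩
        rw [← t.last_faceStep _ (by rwa [hx]), hx, hlast]
  obtain ⟨k, hk, hlast⟩ := key n
  rw [hn, t.last_leafDart, Option.some.injEq] at hlast
  exact hlast ▸ hk

theorem next_next_ne [Finite V] [Finite E] (hinl : ∀ v f, Sum.inl v ∉ 𝓔.leavesAt f)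
    (h : ∀ f, (𝓔.leavesAt f).ncard ≠ 1 ∧ (𝓔.leavesAt f).ncard ≠ 2) (l : S) :
    t.next (t.next l) ≠ l := by
  intro hl
  have hsub : 𝓔.leavesAt (𝓔.faceOf (G.leafDart S l)) ⊆ {Sum.inr l, Sum.inr (t.next l)} := by
    rintro (v | m) hm
    · exact (hinl v _ hm).elim
    · have := t.mem_of_closed (A := {l, t.next l}) (l := l) (m := m) (fun k hk => by
        rcases hk with hk | hk
        · rw [← hl] at hk
          exact Or.inr (t.next.injective hk)
        · exact Or.inl (t.next.injective hk)) (Or.inl rfl) (mem_leavesAt_inr.1 hm).symm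
      simpa using this
  have hle := (Set.ncard_le_ncard hsub (Set.toFinite _)).trans (Set.ncard_insert_le _ _)
  rw [Set.ncard_singleton] at hle
  have hpos := (Set.ncard_pos (Set.toFinite _)).2
    ⟨_, (mem_leavesAt_inr.2 rfl : Sum.inr l ∈ 𝓔.leavesAt (𝓔.faceOf (G.leafDart S l)))⟩
  have := h (𝓔.faceOf (G.leafDart S l))
  omega

end LeafTour

end

/-! ### The embedding of the augmentation -/

section

variable (G : Multigraph V E) (S : Set V) (π : Equiv.Perm S) (hπ : ∀ l, π l ≠ l)

/-- `leafCycles` contains `attachLeaves` on the same vertices. -/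
def leafCyclesInclusion : (G.attachLeaves S).Inclusion (G.leafCycles S π hπ) where
  vert := Function.Embedding.refl _
  dart := ⟨fun d => (Sum.inl d.1, d.2), by
    rintro ⟨e, b⟩ ⟨e', b'⟩ h
    simpa using h⟩
  src_dart _ := rfl
  rev_dart _ := rfl

variable {G S π}

/-- The rotation of `leafCycles` that places the cycles inside the faces: at the leaf `l`, the edge
to its neighbour in `G` is followed by the edge from the leaf before `l` and that one by the edge to
the leaf after `l`. -/
def leafCyclesRotFun (𝓔 : (G.attachLeaves S).PlaneEmbedding) :
    (G.leafCycles S π hπ).Dart → (G.leafCycles S π hπ).Dart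
  | (Sum.inr l, false) => (Sum.inl (Sum.inr l), true)
  | (Sum.inr l, true) => (Sum.inr (π l), false)
  | (Sum.inl (Sum.inr l), true) => (Sum.inr (π⁻¹ l), true)
  | (Sum.inl (Sum.inr l), false) =>
    (G.leafCyclesInclusion S π hπ).dart (𝓔.rot (Sum.inr l, false))
  | (Sum.inl (Sum.inl e), b) => (G.leafCyclesInclusion S π hπ).dart (𝓔.rot (Sum.inl e, b))

theorem leafCyclesRotFun_dart (𝓔 : (G.attachLeaves S).PlaneEmbedding)
    {d : (G.attachLeaves S).Dart} (hd : d ∉ Set.range (G.leafDart S)) :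
    leafCyclesRotFun hπ 𝓔 ((G.leafCyclesInclusion S π hπ).dart d) =
      (G.leafCyclesInclusion S π hπ).dart (𝓔.rot d) := by
  obtain ⟨e | l, b⟩ := d
  · rfl
  · cases b
    · rfl
    · exact (hd ⟨l, rfl⟩).elim

theorem rot_mem_range_leafDart {𝓔 : (G.attachLeaves S).PlaneEmbedding}
    {d : (G.attachLeaves S).Dart} :
    𝓔.rot d ∈ Set.range (G.leafDart S) ↔ d ∈ Set.range (G.leafDart S) := by
  constructor
  · rintro ⟨l, hl⟩
    refine ⟨l, 𝓔.rot.injective ?_⟩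
    rw [rot_leafDart, hl]
  · rintro ⟨l, rfl⟩
    exact ⟨l, (rot_leafDart 𝓔 l).symm⟩

theorem leafCyclesRotFun_bijective [Finite V] [Finite E]
    (𝓔 : (G.attachLeaves S).PlaneEmbedding) :
    Function.Bijective (leafCyclesRotFun hπ 𝓔) := by
  rw [← Finite.surjective_iff_bijective]
  rintro ⟨e | l, b⟩
  · by_cases h : ((e, b) : (G.attachLeaves S).Dart) ∈ Set.range (G.leafDart S)
    · obtain ⟨l, hl⟩ := h
      obtain ⟨rfl, rfl⟩ := Prod.mk.inj hl
      exact ⟨(Sum.inr l, false), rfl⟩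
    · refine ⟨(G.leafCyclesInclusion S π hπ).dart (𝓔.rot.symm (e, b)), ?_⟩
      rw [leafCyclesRotFun_dart hπ 𝓔, Equiv.apply_symm_apply]
      · rfl
      · rwa [← rot_mem_range_leafDart (𝓔 := 𝓔), Equiv.apply_symm_apply]
  · cases b
    · exact ⟨(Sum.inr (π⁻¹ l), true), by simp [leafCyclesRotFun]⟩
    · exact ⟨(Sum.inl (Sum.inr (π l)), true), by simp [leafCyclesRotFun]⟩

/-- `leafCyclesRotFun` as a permutation. -/
noncomputable def leafCyclesRot [Finite V] [Finite E] (𝓔 : (G.attachLeaves S).PlaneEmbedding) :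
    Equiv.Perm (G.leafCycles S π hπ).Dart :=
  Equiv.ofBijective _ (leafCyclesRotFun_bijective hπ 𝓔)

theorem leafCycles_connected (𝓔 : (G.attachLeaves S).PlaneEmbedding) :
    (G.leafCycles S π hπ).toSimpleGraph.Connected := by
  refine 𝓔.connected.mono ?_
  rintro _ _ ⟨d, rfl, rfl⟩
  exact ⟨(G.leafCyclesInclusion S π hπ).dart d, rfl, rfl⟩

variable [Finite V] [Finite E] (𝓔 : (G.attachLeaves S).PlaneEmbedding)

theorem leafCyclesRot_dart {d : (G.attachLeaves S).Dart} (hd : d ∉ Set.range (G.leafDart S)) :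
    leafCyclesRot hπ 𝓔 ((G.leafCyclesInclusion S π hπ).dart d) =
      (G.leafCyclesInclusion S π hπ).dart (𝓔.rot d) :=
  leafCyclesRotFun_dart hπ 𝓔 hd

theorem leafCyclesRot_leafDart (l : S) : leafCyclesRot hπ 𝓔 (Sum.inl (Sum.inr l), true) =
    (Sum.inr (π⁻¹ l), true) := rfl

theorem leafCyclesRot_inr_true (l : S) : leafCyclesRot hπ 𝓔 (Sum.inr l, true) =
    (Sum.inr (π l), false) := rfl

theorem leafCyclesRot_inr_false (l : S) : leafCyclesRot hπ 𝓔 (Sum.inr l, false) =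
    (Sum.inl (Sum.inr l), true) := rfl

theorem src_leafCyclesRot (c : (G.leafCycles S π hπ).Dart) :
    (G.leafCycles S π hπ).src (leafCyclesRot hπ 𝓔 c) = (G.leafCycles S π hπ).src c := by
  obtain ⟨e | l, b⟩ := c
  · by_cases h : ((e, b) : (G.attachLeaves S).Dart) ∈ Set.range (G.leafDart S)
    · obtain ⟨l, hl⟩ := h
      obtain ⟨rfl, rfl⟩ := Prod.mk.inj hl
      rw [leafCyclesRot_leafDart]
      simp
    · exact (congrArg _ (leafCyclesRot_dart hπ 𝓔 h)).trans (𝓔.src_rot _)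
  · cases b <;> rfl

theorem leafCyclesRot_sameCycle_iff (c c' : (G.leafCycles S π hπ).Dart) :
    (leafCyclesRot hπ 𝓔).SameCycle c c' ↔
      (G.leafCycles S π hπ).src c = (G.leafCycles S π hπ).src c' := by
  constructor
  · exact eq_of_sameCycle (src_leafCyclesRot hπ 𝓔)
  have hleaf : ∀ (l : S) (c : (G.leafCycles S π hπ).Dart),
      (G.leafCycles S π hπ).src c = Sum.inr l →
        (leafCyclesRot hπ 𝓔).SameCycle c (Sum.inl (Sum.inr l), true) := by
    rintro l ⟨e | m, b⟩ hc
    · obtain ⟨rfl, rfl⟩ := Prod.mk.inj (src_attachLeaves_eq_inr.1 hc)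
      exact .refl _ _
    · cases b
      · obtain rfl : m = l := by simpa using hc
        exact ⟨1, by simp [leafCyclesRot_inr_false]⟩
      · obtain rfl : π m = l := by simpa using hc
        exact ⟨2, by simp [zpow_ofNat, pow_two, leafCyclesRot_inr_true, leafCyclesRot_inr_false]⟩
  intro h
  obtain ⟨v, hv⟩ : ∃ v, (G.leafCycles S π hπ).src c' = v := ⟨_, rfl⟩
  obtain v | l := v
  · have hlift : ∀ c : (G.leafCycles S π hπ).Dart, (G.leafCycles S π hπ).src c = Sum.inl v →
        ∃ d, c = (G.leafCyclesInclusion S π hπ).dart d ∧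
          (G.attachLeaves S).src d = Sum.inl v := by
      rintro ⟨e | l, b⟩ hc
      · exact ⟨(e, b), rfl, hc⟩
      · cases b <;> simp at hc
    obtain ⟨d, rfl, hd⟩ := hlift c (h.trans hv)
    obtain ⟨d', rfl, hd'⟩ := hlift c' hv
    obtain ⟨n, -, rfl⟩ := ((𝓔.sameCycle_iff d d').2 (hd.trans hd'.symm)).exists_pow_eq'
    have key : ∀ n : ℕ, (leafCyclesRot hπ 𝓔 ^ n) ((G.leafCyclesInclusion S π hπ).dart d) =
          (G.leafCyclesInclusion S π hπ).dart ((𝓔.rot ^ n) d) ∧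
        (G.attachLeaves S).src ((𝓔.rot ^ n) d) = Sum.inl v := by
      intro n
      induction n with
      | zero => exact ⟨rfl, hd⟩
      | succ n ih =>
        simp only [pow_succ', Equiv.Perm.mul_apply]
        refine ⟨?_, (𝓔.src_rot _).trans ih.2⟩
        rw [ih.1, leafCyclesRot_dart]
        rintro ⟨l, hl⟩
        simpa [← hl] using ih.2
    exact ⟨n, by simpa using (key n).1⟩
  · exact (hleaf l c (h.trans hv)).trans (hleaf l c' hv).symm

end

section

variable {G : Multigraph V E} {S : Set V} {𝓔 : (G.attachLeaves S).PlaneEmbedding}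

/-- A labelling of the darts of the augmentation that is constant on facial walks: the faces between
two consecutive leaves are labelled by the earlier leaf, and the faces inside the cycles and the
faces without leaves by the corresponding face of `𝓔`. -/
def LeafTour.label (t : LeafTour 𝓔) (hπ : ∀ l, t.next l ≠ l) :
    (G.leafCycles S t.next hπ).Dart → S ⊕ 𝓔.Face
  | (Sum.inr l, false) => Sum.inr (𝓔.faceOf (G.leafDart S l))
  | (Sum.inr l, true) => Sum.inl l
  | (Sum.inl e, b) => (t.last (e, b)).elim (Sum.inr (𝓔.faceOf (e, b))) Sum.inl

theorem LeafTour.label_surjective (t : LeafTour 𝓔) (hπ : ∀ l, t.next l ≠ l) :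
    Function.Surjective (t.label hπ) := by
  rintro (l | f)
  · exact ⟨(Sum.inr l, true), rfl⟩
  · obtain ⟨⟨e, b⟩, rfl⟩ := Quotient.exists_rep f
    rcases h : t.last (e, b) with _ | l
    · refine ⟨(Sum.inl e, b), ?_⟩
      simp [label, h]
      rfl
    · exact ⟨(Sum.inr l, false), congrArg Sum.inr (t.faceOf_eq _ _ h).symm⟩

variable [Finite V] [Finite E]

theorem LeafTour.label_faceStep (t : LeafTour 𝓔) (hπ : ∀ l, t.next l ≠ l)
    (c : (G.leafCycles S t.next hπ).Dart) :
    t.label hπ ((leafCyclesRot hπ 𝓔 * (G.leafCycles S t.next hπ).rev) c) = t.label hπ c := by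
  rw [Equiv.Perm.mul_apply]
  obtain ⟨e | l, b⟩ := c
  · by_cases h : (G.attachLeaves S).rev (e, b) ∈ Set.range (G.leafDart S)
    · obtain ⟨l, hl⟩ := h
      have hl' : ((e, b) : (G.attachLeaves S).Dart) = (Sum.inr l, false) := by
        rw [← rev_rev _ (e, b), ← hl]
        rfl
      obtain ⟨rfl, rfl⟩ := Prod.mk.inj hl'
      rw [rev_mk, Bool.not_false, leafCyclesRot_leafDart]
      obtain ⟨m, rfl⟩ := t.next.surjective l
      simp [label, t.last_toLeaf]
    · have hrot : leafCyclesRot hπ 𝓔 ((G.leafCycles S t.next hπ).rev (Sum.inl e, b)) =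
          (G.leafCyclesInclusion S t.next hπ).dart (𝓔.faceStep (e, b)) :=
        leafCyclesRot_dart hπ 𝓔 h
      have hlast := t.last_faceStep (e, b) (mt rot_mem_range_leafDart.1 h)
      have hface := 𝓔.faceOf_faceStep (e, b)
      rw [hrot]
      change (t.last (𝓔.faceStep (e, b))).elim (Sum.inr (𝓔.faceOf (𝓔.faceStep (e, b)))) Sum.inl = _
      rw [hlast, hface]
      rfl
  · cases b
    · rw [rev_mk, Bool.not_false, leafCyclesRot_inr_true]
      exact congrArg Sum.inr (t.faceOf_next l)
    · rw [rev_mk, Bool.not_true, leafCyclesRot_inr_false]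
      simp [label, t.last_leafDart]

/-- The embedding of the augmentation. By `card_vertex_add_card_face_le` a lower bound on the number
of faces suffices for Euler's formula. The outer face is the one to the left of `d`. -/
noncomputable def LeafTour.embedding (t : LeafTour 𝓔) (hπ : ∀ l, t.next l ≠ l)
    (d : (G.attachLeaves S).Dart) : (G.leafCycles S t.next hπ).PlaneEmbedding where
  connected := leafCycles_connected hπ 𝓔
  rot := leafCyclesRot hπ 𝓔
  sameCycle_iff := leafCyclesRot_sameCycle_iff hπ 𝓔
  euler := by
    refine le_antisymm (card_vertex_add_card_face_le (leafCycles_connected hπ 𝓔)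
      (leafCyclesRot_sameCycle_iff hπ 𝓔)) ?_
    have hsurj : Function.Surjective (Quotient.lift (s := Equiv.Perm.SameCycle.setoid
        (leafCyclesRot hπ 𝓔 * (G.leafCycles S t.next hπ).rev)) (t.label hπ)
        fun _ _ h => eq_of_sameCycle (t.label_faceStep hπ) h) := fun y => by
      obtain ⟨c, hc⟩ := t.label_surjective hπ y
      exact ⟨Quotient.mk _ c, hc⟩
    have h1 := Nat.card_le_card_of_surjective _ hsurj
    have h2 := 𝓔.euler
    rw [Nat.card_sum] at h1
    rw [Nat.card_sum (α := E ⊕ S) (β := S)]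
    change Nat.card S + Nat.card (Quotient (Equiv.Perm.SameCycle.setoid
      (𝓔.rot * (G.attachLeaves S).rev))) ≤ _ at h1
    omega
  outer := Quotient.mk _ ((G.leafCyclesInclusion S t.next hπ).dart d)

theorem LeafTour.embedding_induces (t : LeafTour 𝓔) (hπ : ∀ l, t.next l ≠ l)
    {d : (G.attachLeaves S).Dart} (hd : 𝓔.faceOf d = 𝓔.outer) :
    (t.embedding hπ d).Induces (G.leafCyclesInclusion S t.next hπ) 𝓔 := by
  refine ⟨fun c => ?_, _, d, rfl, hd, .refl _⟩
  by_cases hc : c ∈ Set.range (G.leafDart S)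
  · obtain ⟨l, rfl⟩ := hc
    -- the two cycle edges at `l` come between the only dart of `G` at `l` and itself
    refine ⟨3, by norm_num, ?_, fun j hj hj3 => ?_⟩
    · rw [rot_leafDart]
      change leafCyclesRot hπ 𝓔 (leafCyclesRot hπ 𝓔 (leafCyclesRot hπ 𝓔
        (Sum.inl (Sum.inr l), true))) = (Sum.inl (Sum.inr l), true)
      rw [leafCyclesRot_leafDart, leafCyclesRot_inr_true, leafCyclesRot_inr_false]
      simp
    · have hout : ∀ (m : S) (b : Bool), ((Sum.inr m, b) : (G.leafCycles S t.next hπ).Dart) ∉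
          Set.range (G.leafCyclesInclusion S t.next hπ).dart := by
        rintro m b ⟨x, hx⟩
        exact Sum.inl_ne_inr (congrArg Prod.fst hx)
      obtain rfl | rfl : j = 1 ∨ j = 2 := by omega
      · exact hout (t.next⁻¹ l) true
      · exact hout (t.next (t.next⁻¹ l)) false
  · exact ⟨1, one_pos, leafCyclesRot_dart hπ 𝓔 hc, fun j hj hj1 => by omega⟩

end

end Multigraph

theorem mainTheorem4 {V E : Type u} [Finite V] [Finite E] (R : Multigraph V E)
    (hconn : R.IsKConnected 3) (hplanar : R.IsPlanar) (hreg : R.IsRegular 3)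
    (s : E → ℕ) (hs : ∀ e, s e ≤ 2) (𝓔 : (R.leafySubdivision s).PlaneEmbedding) :
    𝓔.HasSolution ↔ ∀ f : 𝓔.Face, (𝓔.leavesAt f).ncard ≠ 1 ∧ (𝓔.leavesAt f).ncard ≠ 2 := by
  have hdeg := Multigraph.degree_leafySubdivision_inl (s := s) hreg
  constructor
  · obtain ⟨𝓡⟩ := hplanar
    obtain ⟨v⟩ := 𝓡.connected.nonempty
    exact fun h f => h.ncard_leavesAt_ne hdeg ⟨Sum.inl v, by simp⟩ f
  · intro h
    obtain ⟨t⟩ := Multigraph.exists_leafTour 𝓔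
    have hnext := t.next_next_ne (fun v f hv => by
      have := hv.1
      change ((R.subdivide s).attachLeaves (Set.range Sum.inr)).degree _ = 1 at this
      rw [hdeg] at this
      omega) h
    have hnext₁ : ∀ l, t.next l ≠ l := fun l hl => hnext l (by rw [hl, hl])
    obtain ⟨d, hd⟩ := Quotient.exists_rep 𝓔.outer
    have hreg' : ((R.subdivide s).leafCycles (Set.range Sum.inr) t.next hnext₁).IsRegular 3 := by
      rintro (v | l)
      · rw [Multigraph.degree_leafCycles_inl, hdeg]
      · exact Multigraph.degree_leafCycles_inr ..
    exact ⟨_, _, inferInstance, inferInstance, _, hreg',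
      (Multigraph.isThreeEdgeConnected_leafCycles (hconn.isThreeEdgeConnected hreg) hs
        (fun _ => Iff.rfl) hnext₁ hnext).isKConnected hreg', _, _, t.embedding_induces hnext₁ hd⟩
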